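/- Let $\mathcal X$ be a unital $C^*$-algebra and $\mathcal M$ a $\sigma$-finite von Neumann algebra on a Hilbert space $\mathcal H$. Let $\mathcal M_*$ be the space of normal linear functionals on $\mathcal M$, i.e. those of the form $A\mapsto \mathrm{Tr}[\sigma A]$ with $\sigma$ a trace class operator on $\mathcal H$. Let $\mathrm{CP}(\mathcal X,\mathcal M)$ be the set of completely positive linear maps $\mathcal X\to\mathcal M$; write $T_1\le T_2$ if $T_2-T_1\in \mathrm{CP}(\mathcal X,\mathcal M)$, and $T_1\perp T_2$ if $0$ is the only $T'\in\mathrm{CP}(\mathcal X,\mathcal M)$ with $T'\le T_1$ and $T'\le T_2$. Let $T\in \mathrm{CP}(\mathcal X,\mathcal M)$ and let $(\pi_T,\mathcal K_T,V_T)$ be a minimal Stinespring representation of $T$: $\pi_T$ is a representation of $\mathcal X$ on the Hilbert space $\mathcal K_T$, $V_T\in B(\mathcal H,\mathcal K_T)$, $T(X)=V_T^*\pi_T(X)V_T$ for all $X\in\mathcal X$, and $\pi_T(\mathcal X)V_T\mathcal H$ spans a dense subspace of $\mathcal K_T$. Let $\pi_T(\mathcal X)^c\subseteq B(\mathcal K_T)$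 be the $\sigma$-weak closure of the linear span of all $R\in\pi_T(\mathcal X)'$ such that $0\le R\le 1$ and the map $X\mapsto V_T^*R\pi_T(X)V_T$ belongs to $\mathrm{CP}(\mathcal X,\mathcal M)$. Let $(S,\mathcal F,\mu)$ be a CP-measure space of $T$: $(S,\mathcal F)$ is a measurable space and $\mu:\mathcal F\to \mathrm{CP}(\mathcal X,\mathcal M)$ satisfies $\mu(S)=T$ and $\rho(\mu(\bigcup_i\Delta_i)X)=\sum_i\rho(\mu(\Delta_i)X)$ for all $\rho\in\mathcal M_*$, all $X\in\mathcal X$ and all sequences $(\Delta_i)$ of mutually disjoint sets in $\mathcal F$. It is called orthogonal if $\mu(\Delta)\perp\mu(\Delta^c)$ for every $\Delta\in\mathcal F$. Let $\nu$ be a finite positive measure on $(S,\mathcal F)$ that is equivalent to the measure $\Delta\mapsto\rho_0(\mu(\Delta)1)$ for some normal faithful state $\rho_0$ on $\mathcal M$. Then there is a unique linear map $\kappa_\mu:L^\infty(\nu)\to\pi_T(\mathcal X)^c$ such that, for all $f\in L^\infty(\nu)$ and $X\in\mathcal X$, one has $V_T^*\kappa_\mu(f)\pi_T(X)V_T\in\mathcal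 M$ and $$\rho\bigl(V_T^*\kappa_\mu(f)\pi_T(X)V_T\bigr)=\int f(s)\,d\rho(\mu(s)X)\qquad\text{for every }\rho\in\mathcal M_*,$$ where the integral is taken with respect to the complex measure $\Delta\mapsto\rho(\mu(\Delta)X)$. Moreover, the following conditions are equivalent: (1) $(S,\mathcal F,\mu)$ is an orthogonal CP-measure space of $T$; (2) $\kappa_\mu$ is a $*$-isomorphism of $L^\infty(\nu)$ into $\pi_T(\mathcal X)^c$, that is, an injective $*$-homomorphism; (3) $\kappa_\mu$ is a $*$-representation, that is, a $*$-homomorphism. If these conditions hold, then the range $\{\kappa_\mu(f) : f\in L^\infty(\nu)\}$ is an abelian von Neumann subalgebra of $\pi_T(\mathcal X)^c$ (containing the identity operator of $\mathcal K_T$). -/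

import Mathlib

open MeasureTheory Function
open scoped ENNReal CStarAlgebra ComplexOrder

noncomputable section

/-! ### Normal functionals and the `σ`-weak topology -/

section SigmaWeak

variable {H : Type*} [NormedAddCommGroup H] [InnerProductSpace ℂ H] [CompleteSpace H]

/-- The functional `A ↦ Tr[σ A]` of the trace class operator `σ = ∑ₙ |ηₙ⟩⟨ξₙ|`, where `ξ` and `η`
are square-summable sequences in `H`. The trace class operators on `H` are exactly the operators
of this form. -/
def traceClassFunctional (ξ η : lp (fun _ : ℕ => H) 2) (A : H →L[ℂ] H) : ℂ :=
  ∑' n, inner ℂ (ξ n) (A (η n))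

variable (H) in
/-- The `σ`-weak topology on `B(H)`: the coarsest topology for which the functionals
`A ↦ Tr[σ A]`, with `σ` of trace class, are continuous. -/
@[reducible] def sigmaWeakTopology : TopologicalSpace (H →L[ℂ] H) :=
  TopologicalSpace.induced
    (fun (A : H →L[ℂ] H) (p : lp (fun _ : ℕ => H) 2 × lp (fun _ : ℕ => H) 2) =>
      traceClassFunctional p.1 p.2 A) inferInstance

/-- A linear functional `ρ` on `M` is normal if `ρ(A) = Tr[σ A]` on `M` for some trace class
operator `σ` on `H`. -/
def VonNeumannAlgebra.IsNormal (M : VonNeumannAlgebra H)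
    (ρ : M.toStarSubalgebra →ₗ[ℂ] ℂ) : Prop :=
  ∃ ξ η : lp (fun _ : ℕ => H) 2, ∀ a : M.toStarSubalgebra,
    ρ a = traceClassFunctional ξ η (a : H →L[ℂ] H)

/-- Normal faithful states on `M`. -/
structure VonNeumannAlgebra.IsNormalFaithfulState (M : VonNeumannAlgebra H)
    (ρ : M.toStarSubalgebra →ₗ[ℂ] ℂ) : Prop where
  normal : M.IsNormal ρ
  map_nonneg : ∀ a : M.toStarSubalgebra, 0 ≤ (a : H →L[ℂ] H) → 0 ≤ ρ a
  map_one : ρ 1 = 1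
  faithful : ∀ a : M.toStarSubalgebra, 0 ≤ (a : H →L[ℂ] H) → ρ a = 0 → a = 0

/-- `M` is `σ`-finite: every family of nonzero, mutually orthogonal projections of `M` is
countable. -/
def VonNeumannAlgebra.IsSigmaFinite (M : VonNeumannAlgebra H) : Prop :=
  ∀ P : Set (H →L[ℂ] H), (∀ p ∈ P, p ∈ M ∧ IsStarProjection p ∧ p ≠ 0) →
    P.Pairwise (fun p q => p * q = 0) → P.Countable

end SigmaWeak

variable {X : Type*} [CStarAlgebra X] [PartialOrder X] [StarOrderedRing X]
  {H : Type*} [NormedAddCommGroup H] [InnerProductSpace ℂ H] [CompleteSpace H]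
  {K : Type*} [NormedAddCommGroup K] [InnerProductSpace ℂ K] [CompleteSpace K]
  {M : VonNeumannAlgebra H} {S : Type*} [MeasurableSpace S]

/-! ### Completely positive maps with values in a von Neumann algebra -/

variable (X M) in
/-- `CP(X, M)`: the completely positive maps from `X` to `B(H)` with range in `M`. -/
structure CPMap extends X →CP (H →L[ℂ] H) where
  map_mem' : ∀ x, toFun x ∈ M.toStarSubalgebra

instance : CoeFun (CPMap X M) (fun _ => X → M.toStarSubalgebra) :=
  ⟨fun T x => ⟨T.toFun x, T.map_mem' x⟩⟩

/-- `T₁ ≤ T₂` if `T₂ - T₁` is an element of `CP(X, M)`. -/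
instance : LE (CPMap X M) :=
  ⟨fun T₁ T₂ => ∃ R : CPMap X M, ∀ x, T₂ x - T₁ x = R x⟩

/-- `T₁ ⊥ T₂`: the only `T' ∈ CP(X, M)` with `T' ≤ T₁` and `T' ≤ T₂` is `0`. -/
def CPMap.Orthogonal (T₁ T₂ : CPMap X M) : Prop :=
  ∀ T' : CPMap X M, T' ≤ T₁ → T' ≤ T₂ → ∀ x, T' x = 0

/-! ### Minimal Stinespring representations and the relative commutant -/

variable (K) in
/-- A minimal Stinespring representation `(π, K, V)` of `T`. -/
structure MinimalStinespring (T : CPMap X M) where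
  π : X →⋆ₐ[ℂ] (K →L[ℂ] K)
  V : H →L[ℂ] K
  eq_compress : ∀ x, (T x : H →L[ℂ] H) = V.adjoint ∘L π x ∘L V
  dense : (Submodule.span ℂ {k : K | ∃ x ξ, k = π x (V ξ)}).topologicalClosure = ⊤

/-- The `M`-relative commutant `π_T(X)ᶜ` of `π_T(X)`: the `σ`-weak closure of the linear span of
the `R ∈ π_T(X)'` with `0 ≤ R ≤ 1` for which `x ↦ V* R π(x) V` is an element of `CP(X, M)`. -/
def MinimalStinespring.relCommutant {T : CPMap X M} (D : MinimalStinespring K T) :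
    Set (K →L[ℂ] K) :=
  @closure _ (sigmaWeakTopology K)
    (Submodule.span ℂ {R : K →L[ℂ] K | R ∈ Set.centralizer (Set.range D.π) ∧ 0 ≤ R ∧ R ≤ 1 ∧
      ∃ T' : CPMap X M, ∀ x, (T' x : H →L[ℂ] H) = D.V.adjoint ∘L R ∘L D.π x ∘L D.V} :
      Set (K →L[ℂ] K))

/-! ### CP-measure spaces -/

variable (S X M) in
/-- A `CP(X, M)`-valued measure on the measurable space `S`. Only the values on measurable sets
are meaningful. -/
structure CPMeasure where
  toFun : Set S → CPMap X M
  hasSum_iUnion : ∀ Δ : ℕ → Set S, (∀ i, MeasurableSet (Δ i)) → Pairwise (Disjoint on Δ) →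
    ∀ ρ : M.toStarSubalgebra →ₗ[ℂ] ℂ, M.IsNormal ρ → ∀ x : X,
      HasSum (fun i => ρ (toFun (Δ i) x)) (ρ (toFun (⋃ i, Δ i) x))

instance : CoeFun (CPMeasure X M S) (fun _ => Set S → CPMap X M) := ⟨CPMeasure.toFun⟩

/-- `(S, μ)` is an orthogonal CP-measure space with barycenter `T`. -/
def CPMeasure.IsOrthogonalOf (μ : CPMeasure X M S) (T : CPMap X M) : Prop :=
  μ Set.univ = T ∧ ∀ Δ : Set S, MeasurableSet Δ → (μ Δ).Orthogonal (μ Δᶜ)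

open Classical in
/-- The complex measure `Δ ↦ ρ(μ(Δ, x))`, for a normal functional `ρ` on `M` and `x ∈ X`. -/
def CPMeasure.scalarMeasure (μ : CPMeasure X M S) {ρ : M.toStarSubalgebra →ₗ[ℂ] ℂ}
    (hρ : M.IsNormal ρ) (x : X) : ComplexMeasure S where
  measureOf' Δ := if MeasurableSet Δ then ρ (μ Δ x) else 0
  empty' := by
    have h := μ.hasSum_iUnion (fun _ => ∅) (fun _ => MeasurableSet.empty)
      (fun _ _ _ => by simp [onFun]) ρ hρ x
    simpa [summable_const_iff] using h.summable
  not_measurable' Δ hΔ := if_neg hΔ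
  m_iUnion' Δ hΔ hd := by
    simpa [hΔ, MeasurableSet.iUnion hΔ] using μ.hasSum_iUnion Δ hΔ hd ρ hρ x

/-- `ν` and `ρ ∘ μ : Δ ↦ ρ(μ(Δ, 1))` are equivalent measures (they have the same null sets). -/
def CPMeasure.IsEquivalentTo (μ : CPMeasure X M S) (ρ : M.toStarSubalgebra →ₗ[ℂ] ℂ)
    (ν : Measure S) : Prop :=
  ∀ Δ : Set S, MeasurableSet Δ → (ν Δ = 0 ↔ ρ (μ Δ 1) = 0)

/-- The defining property of the map `κ_μ : L^∞(ν) → π_T(X)ᶜ`: for all `f` and `x`, the operator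
`V* κ(f) π(x) V` is the element `∫ f(s) dμ(s, x)` of `M`, that is,
`ρ(V* κ(f) π(x) V) = ∫ f(s) dρ(μ(s, x))` for every normal functional `ρ` on `M`. -/
structure CPMeasure.IsKappa (μ : CPMeasure X M S) {T : CPMap X M} (D : MinimalStinespring K T)
    (ν : Measure S) (κ : Lp ℂ ∞ ν →ₗ[ℂ] (K →L[ℂ] K)) : Prop where
  mem_relCommutant : ∀ f, κ f ∈ D.relCommutant
  integral_eq : ∀ (f : Lp ℂ ∞ ν) (x : X), ∃ a : M.toStarSubalgebra,
    (a : H →L[ℂ] H) = D.V.adjoint ∘L κ f ∘L D.π x ∘L D.V ∧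
    ∀ (ρ : M.toStarSubalgebra →ₗ[ℂ] ℂ) (hρ : M.IsNormal ρ),
      ρ a = ∫ᵛ s, f s ∂[ContinuousLinearMap.mul ℝ ℂ; μ.scalarMeasure hρ x]

/-- A linear map `κ : L^∞(ν) → B(K)` is a `*`-representation if it is multiplicative and preserves
the involution. Here `f • g` is the pointwise product and `star f` the complex conjugate. -/
structure IsStarRepresentation {ν : Measure S} (κ : Lp ℂ ∞ ν →ₗ[ℂ] (K →L[ℂ] K)) : Prop where
  map_mul : ∀ f g : Lp ℂ ∞ ν, κ (f • g : Lp ℂ ∞ ν) = κ f * κ g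
  map_star : ∀ f : Lp ℂ ∞ ν, κ (star f) = star (κ f)

end

/-!
Every `μ(Δ) ≤ T` has a Radon–Nikodym derivative `P(Δ) ∈ π(X)'` with respect to `T`, and
`κ(f) = ∫ f dP`. A lift of `u ∈ M'` to `K` is an operator `W` with `W π(x) V = π(x) V u`, and
`π_T(X)ᶜ` is the commutant of `π(X)` and of these lifts. It is therefore a von Neumann algebra, and
its positive elements are the Radon–Nikodym derivatives of the elements of `CP(X, M)`.

Let `R` be the derivative of `T₁ ≤ T`. Then `R(1 - R) = R - R² ≥ 0` is the derivative of a map below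
both `T₁` and `T - T₁`, and conversely, when `R` is a projection, the derivative of such a map is
annihilated by `R` and by `1 - R`. Thus `T₁ ⊥ T - T₁` exactly if `R` is a projection, and `μ` is
orthogonal exactly if `P` is projection valued, that is, if `κ` is multiplicative.

Let `P` be projection valued and `Tr[σ ·]`, with `σ = ∑ₙ |ηₙ⟩⟨ξₙ|`, a faithful normal state on `M`.
The vector `w = (V ηₙ)ₙ` of `ℓ²(K)` separates the amplification of `π_T(X)ᶜ`. An element `B` of the
bicommutant of the range of `κ` maps `w` into the closed span of the vectors `P(Δ) w`, and scalar
Radon–Nikodym derivatives produce an `f` with `B w = κ(f) w`. So `B = κ(f)`, and the range of `κ`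
is its own bicommutant.
-/

section OperatorMatrix

/-! ### Positivity of operator matrices -/

theorem eq_zero_of_mul_mul_self_eq_zero {A : Type*} [NonUnitalCStarAlgebra A] {a : A}
    (ha : IsSelfAdjoint a) (h : a * a * a = 0) : a = 0 := by
  have hsq : a * a = 0 := by
    rw [← CStarRing.star_mul_self_eq_zero_iff, star_mul, ha.star_eq, ← mul_assoc, h, zero_mul]
  rwa [← CStarRing.star_mul_self_eq_zero_iff, ha.star_eq]

theorem negPart_mul_mul_negPart {A : Type*} [CStarAlgebra A] {a : A} (ha : IsSelfAdjoint a) :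
    a⁻ * a * a⁻ = -(a⁻ * a⁻ * a⁻) := by
  nth_rw 2 [← CFC.posPart_sub_negPart a ha]
  rw [mul_sub, CFC.negPart_mul_posPart, zero_sub, neg_mul]

section StarOrdered

-- Instance search does not find the real functional calculus on `CStarMatrix n n A`, so the facts
-- that need it are stated for an abstract algebra.
variable {A : Type*} [CStarAlgebra A] [PartialOrder A] [StarOrderedRing A] {a : A}

theorem exists_star_mul_self_eq (ha : 0 ≤ a) : ∃ b : A, star b * b = a :=
  let ⟨b, hb⟩ := CStarAlgebra.nonneg_iff_eq_star_mul_self.mp ha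
  ⟨b, hb.symm⟩

theorem nonneg_of_star_mul_mul_eq_neg_imp_eq_zero (ha : IsSelfAdjoint a)
    (h : ∀ b c : A, star c * a * c = -(star b * b) → b = 0) : 0 ≤ a := by
  have hneg : star a⁻ = a⁻ := (CFC.negPart_nonneg a).isSelfAdjoint
  have hcube : 0 ≤ a⁻ * a⁻ * a⁻ := by
    simpa only [hneg] using star_left_conjugate_nonneg (CFC.negPart_nonneg a) a⁻
  obtain ⟨b, hb⟩ := exists_star_mul_self_eq hcube
  have hb0 : b = 0 := h b a⁻ (by rw [hneg, negPart_mul_mul_negPart ha, hb])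
  exact (CFC.negPart_eq_zero_iff a ha).mp
    (eq_zero_of_mul_mul_self_eq_zero hneg (by rw [← hb, hb0, mul_zero]))

end StarOrdered

variable {H : Type*} [NormedAddCommGroup H] [InnerProductSpace ℂ H] [CompleteSpace H]
  {n : Type*} [Fintype n]

/-- The quadratic form `ξ ↦ ∑ᵢⱼ ⟨ξᵢ, Aᵢⱼ ξⱼ⟩` of an operator matrix, which detects its
positivity. -/
noncomputable def matrixForm (A : CStarMatrix n n (H →L[ℂ] H)) (ξ : n → H) : ℂ :=
  ∑ i, ∑ j, inner ℂ (ξ i) (A i j (ξ j))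

theorem matrixForm_star_mul_mul (A B : CStarMatrix n n (H →L[ℂ] H)) (ξ : n → H) :
    matrixForm (star B * A * B) ξ = matrixForm A fun k => ∑ i, B k i (ξ i) := by
  have entry : ∀ i j, inner ℂ (ξ i) ((star B * A * B) i j (ξ j)) =
      ∑ k, ∑ l, inner ℂ (B k i (ξ i)) (A k l (B l j (ξ j))) := fun i j => by
    rw [mul_assoc, CStarMatrix.mul_apply, sum_apply, inner_sum]
    refine Finset.sum_congr rfl fun k _ => ?_
    rw [CStarMatrix.star_apply, mul_apply_eq_comp, ContinuousLinearMap.star_eq_adjoint,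
      ContinuousLinearMap.adjoint_inner_right, CStarMatrix.mul_apply, sum_apply, inner_sum]
    rfl
  simp_rw [matrixForm, entry, map_sum, sum_inner, inner_sum]
  rw [Finset.sum_congr rfl fun i _ => Finset.sum_comm, Finset.sum_comm]
  refine Finset.sum_congr rfl fun k _ => ?_
  rw [Finset.sum_congr rfl fun i _ => Finset.sum_comm, Finset.sum_comm]

theorem matrixForm_star_mul_self (B : CStarMatrix n n (H →L[ℂ] H)) (ξ : n → H) :
    matrixForm (star B * B) ξ = ((∑ l, ‖∑ j, B l j (ξ j)‖ ^ 2 : ℝ) : ℂ) := by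
  classical
  rw [← mul_one (star B), matrixForm_star_mul_mul, matrixForm]
  push_cast
  refine Finset.sum_congr rfl fun l _ => ?_
  rw [Finset.sum_eq_single l (fun k _ hk => by rw [CStarMatrix.one_apply_ne hk.symm]; simp)
    (by simp), CStarMatrix.one_apply_eq]
  exact inner_self_eq_norm_sq_to_K (𝕜 := ℂ) _

theorem matrixForm_nonneg {A : CStarMatrix n n (H →L[ℂ] H)} (hA : 0 ≤ A) (ξ : n → H) :
    0 ≤ matrixForm A ξ := by
  classical
  obtain ⟨B, rfl⟩ := exists_star_mul_self_eq hA
  rw [matrixForm_star_mul_self]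
  exact_mod_cast Finset.sum_nonneg fun l _ => by positivity

theorem eq_zero_of_matrixForm_star_mul_self_nonpos {B : CStarMatrix n n (H →L[ℂ] H)}
    (h : ∀ ξ, matrixForm (star B * B) ξ ≤ 0) : B = 0 := by
  classical
  refine CStarMatrix.ext fun l i => ContinuousLinearMap.ext fun v => ?_
  have hle : ∑ k, ‖∑ j, B k j (Pi.single (M := fun _ => H) i v j)‖ ^ 2 ≤ 0 := by
    have := h (Pi.single i v)
    rw [matrixForm_star_mul_self] at this
    exact_mod_cast this
  have hl := (Finset.sum_eq_zero_iff_of_nonneg fun k _ => by positivity).mp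
    (hle.antisymm (Finset.sum_nonneg fun k _ => by positivity)) l (Finset.mem_univ l)
  rw [Finset.sum_eq_single i (fun j _ hj => by simp [Pi.single_eq_of_ne hj]) (by simp)] at hl
  simpa using hl

theorem nonneg_of_matrixForm_nonneg {A : CStarMatrix n n (H →L[ℂ] H)} (hA : IsSelfAdjoint A)
    (h : ∀ ξ, 0 ≤ matrixForm A ξ) : 0 ≤ A := by
  classical
  refine nonneg_of_star_mul_mul_eq_neg_imp_eq_zero hA fun B C hBC =>
    eq_zero_of_matrixForm_star_mul_self_nonpos fun ξ => ?_
  have hneg : matrixForm (-(star B * B)) ξ = -matrixForm (star B * B) ξ := by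
    simp only [matrixForm, ← Finset.sum_neg_distrib, ← inner_neg_right]
    rfl
  rw [← neg_nonneg, ← hneg, ← hBC, matrixForm_star_mul_mul]
  exact h _

end OperatorMatrix

section CompletelyPositive

/-! ### Completely positive maps -/

variable {X : Type*} [CStarAlgebra X] [PartialOrder X] [StarOrderedRing X]
  {H : Type*} [NormedAddCommGroup H] [InnerProductSpace ℂ H] [CompleteSpace H]
  {K : Type*} [NormedAddCommGroup K] [InnerProductSpace ℂ K] [CompleteSpace K]

theorem ofMatrix_star_mul_nonneg {n : Type*} [Fintype n] (x : n → X) :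
    0 ≤ (CStarMatrix.ofMatrix <| Matrix.of fun i j => star (x i) * x j : CStarMatrix n n X) := by
  classical
  rcases isEmpty_or_nonempty n with _ | ⟨⟨i₀⟩⟩
  · exact (CStarMatrix.ext fun i => isEmptyElim i).le
  · let row : CStarMatrix n n X :=
      CStarMatrix.ofMatrix <| Matrix.of fun k j => if k = i₀ then x j else 0
    convert star_mul_self_nonneg row using 1
    ext i j
    rw [CStarMatrix.mul_apply]
    simp [row, CStarMatrix.star_apply, apply_ite star]

theorem sum_inner_star_mul_nonneg (Φ : X →CP (H →L[ℂ] H)) (c : X →₀ H) :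
    0 ≤ c.sum fun x ξ => c.sum fun y η => inner ℂ ξ (Φ (star x * y) η) := by
  have := matrixForm_nonneg (Φ.map_cstarMatrix_nonneg _
    (ofMatrix_star_mul_nonneg fun i : c.support => (i : X))) fun i => c i
  simp only [Finsupp.sum]
  rw [← Finset.sum_coe_sort c.support]
  simp_rw [← Finset.sum_coe_sort c.support (fun y => inner ℂ (c _) (Φ (star _ * y) (c y)))]
  exact this

theorem posSemidef_star_mul (Φ : X →CP (H →L[ℂ] H)) :
    (Matrix.of fun x y => Φ (star x * y) : Matrix X X (H →L[ℂ] H)).PosSemidef := by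
  have hiff := (RKHS.posSemidef_tfae
    (K := (Matrix.of fun x y => Φ (star x * y) : Matrix X X (H →L[ℂ] H)))).out 0 2
  refine hiff.mpr ⟨?_, fun c => ?_⟩
  · ext1 x y
    simp [Matrix.conjTranspose_apply, ← map_star]
  · have hconj : (c.sum fun x ξ => c.sum fun y η => inner ℂ (Φ (star y * x) ξ) η) =
        star (c.sum fun x ξ => c.sum fun y η => inner ℂ ξ (Φ (star x * y) η)) := by
      rw [Finsupp.sum_comm]
      simp only [Finsupp.sum, star_sum, RCLike.star_def, inner_conj_symm]
    simp only [Matrix.of_apply]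
    rw [hconj, RCLike.star_def, RCLike.conj_re]
    exact (RCLike.nonneg_iff.mp (sum_inner_star_mul_nonneg Φ c)).1

theorem exists_kolmogorov_decomposition (Φ : X →CP (H →L[ℂ] H)) :
    ∃ (k : Matrix X X (H →L[ℂ] H)) (_ : Fact k.PosSemidef) (W : X → H →L[ℂ] RKHS.OfKernel k),
      ∀ x y ξ η, inner ℂ (W x ξ) (W y η) = inner ℂ ξ (Φ (star x * y) η) := by
  have : Fact (Matrix.PosSemidef _) := ⟨posSemidef_star_mul Φ⟩
  refine ⟨_, this, RKHS.kerFun _, fun x y ξ η => ?_⟩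
  rw [← RKHS.kernel_inner (H := RKHS.OfKernel _) y x ξ η, RKHS.OfKernel.kernel_ofKernel,
    Matrix.of_apply, ← ContinuousLinearMap.adjoint_inner_right,
    ← ContinuousLinearMap.star_eq_adjoint, ← map_star, star_mul, star_star]

theorem exists_completelyPositiveMap_conj (W : H →L[ℂ] K) :
    ∃ Φ : (K →L[ℂ] K) →CP (H →L[ℂ] H), ∀ A, Φ A = W.adjoint ∘L A ∘L W := by
  let φ : (K →L[ℂ] K) →ₗ[ℂ] (H →L[ℂ] H) :=
    { toFun := fun A => W.adjoint ∘L A ∘L W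
      map_add' := fun A B => by ext; simp
      map_smul' := fun c A => by ext; simp }
  have hstar : ∀ A, φ (star A) = star (φ A) := fun A => by
    simp only [φ, LinearMap.coe_mk, AddHom.coe_mk, ContinuousLinearMap.star_eq_adjoint,
      ContinuousLinearMap.adjoint_comp, ContinuousLinearMap.adjoint_adjoint,
      ContinuousLinearMap.comp_assoc]
  refine ⟨⟨φ, fun n A hA => nonneg_of_matrixForm_nonneg ?_ fun ξ => ?_⟩, fun _ => rfl⟩
  · ext1 i j
    rw [CStarMatrix.star_apply, CStarMatrix.map_apply, CStarMatrix.map_apply, ← hstar,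
      ← CStarMatrix.star_apply, hA.isSelfAdjoint.star_eq]
  · exact (matrixForm_nonneg hA fun i => W (ξ i)).trans_eq <|
      Finset.sum_congr rfl fun i _ => Finset.sum_congr rfl fun j _ =>
        (ContinuousLinearMap.adjoint_inner_right W (ξ i) (A i j (W (ξ j)))).symm

theorem exists_completelyPositiveMap_compress (π : X →⋆ₐ[ℂ] (K →L[ℂ] K)) (V : H →L[ℂ] K)
    {Q : K →L[ℂ] K} (hQ : 0 ≤ Q) (hQπ : ∀ x, Commute Q (π x)) :
    ∃ Φ : X →CP (H →L[ℂ] H), ∀ x, Φ x = V.adjoint ∘L Q ∘L π x ∘L V := by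
  obtain ⟨Φ, hΦ⟩ := exists_completelyPositiveMap_conj ((CFC.sqrt Q : K →L[ℂ] K) ∘L V)
  have hsqrt : (CFC.sqrt Q : K →L[ℂ] K).adjoint = CFC.sqrt Q := (CFC.sqrt_nonneg Q).isSelfAdjoint
  refine ⟨⟨Φ.toLinearMap ∘ₗ π.toLinearMap, fun n A hA => ?_⟩, fun x => ?_⟩
  · exact Φ.map_cstarMatrix_nonneg _ (CompletelyPositiveMapClass.map_cstarMatrix_nonneg' π n A hA)
  · have hcomm : CFC.sqrt Q * π x = π x * CFC.sqrt Q := (hQπ x).cfcₙ_nnreal _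
    calc Φ (π x) = V.adjoint ∘L (CFC.sqrt Q * (π x * CFC.sqrt Q)) ∘L V := by
          rw [hΦ, ContinuousLinearMap.adjoint_comp, hsqrt]; rfl
      _ = V.adjoint ∘L Q ∘L π x ∘L V := by
          rw [← hcomm, ← mul_assoc, CFC.sqrt_mul_sqrt_self Q]; rfl

end CompletelyPositive

section TraceClass

/-! ### Normal functionals -/

theorem summable_norm_mul_norm {E : Type*} [NormedAddCommGroup E] (ξ η : lp (fun _ : ℕ => E) 2) :
    Summable fun n => ‖ξ n‖ * ‖η n‖ :=
  lp.summable_mul (by rw [Real.holderConjugate_iff]; norm_num) ξ η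

variable {H : Type*} [NormedAddCommGroup H] [InnerProductSpace ℂ H]

theorem norm_inner_apply_le (A : H →L[ℂ] H) (ξ η : H) :
    ‖inner ℂ ξ (A η)‖ ≤ ‖A‖ * (‖ξ‖ * ‖η‖) :=
  calc ‖inner ℂ ξ (A η)‖ ≤ ‖ξ‖ * (‖A‖ * ‖η‖) :=
        (norm_inner_le_norm _ _).trans (by gcongr; exact A.le_opNorm η)
    _ = ‖A‖ * (‖ξ‖ * ‖η‖) := by ring

theorem summable_traceClassFunctional (ξ η : lp (fun _ : ℕ => H) 2) (A : H →L[ℂ] H) :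
    Summable fun n => inner ℂ (ξ n) (A (η n)) :=
  .of_norm_bounded ((summable_norm_mul_norm ξ η).mul_left ‖A‖) fun n =>
    norm_inner_apply_le A (ξ n) (η n)

theorem norm_traceClassFunctional_le (ξ η : lp (fun _ : ℕ => H) 2) (A : H →L[ℂ] H) :
    ‖traceClassFunctional ξ η A‖ ≤ (∑' n, ‖ξ n‖ * ‖η n‖) * ‖A‖ := by
  rw [mul_comm]
  exact tsum_of_norm_bounded ((summable_norm_mul_norm ξ η).hasSum.mul_left ‖A‖) fun n =>
    norm_inner_apply_le A (ξ n) (η n)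

/-- `A ↦ Tr[σ A]`, for `σ = ∑ₙ |ηₙ⟩⟨ξₙ|`, as a functional continuous in the operator norm. -/
noncomputable def traceClassCLM (ξ η : lp (fun _ : ℕ => H) 2) : (H →L[ℂ] H) →L[ℂ] ℂ :=
  LinearMap.mkContinuous
    { toFun := traceClassFunctional ξ η
      map_add' := fun A B => by
        simp only [traceClassFunctional, add_apply, inner_add_right]
        exact (summable_traceClassFunctional ξ η A).tsum_add (summable_traceClassFunctional ξ η B)
      map_smul' := fun c A => by
        simp only [traceClassFunctional, smul_apply, inner_smul_right]
        exact tsum_mul_left }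
    _ (norm_traceClassFunctional_le ξ η)

theorem traceClassFunctional_single (ξ η : H) (A : H →L[ℂ] H) :
    traceClassFunctional (lp.single 2 0 ξ) (lp.single 2 0 η) A = inner ℂ ξ (A η) := by
  rw [traceClassFunctional, tsum_eq_single 0 fun n hn => by
    rw [lp.single_apply_ne _ _ _ hn, inner_zero_left]]
  simp only [lp.single_apply_self]

theorem continuous_inner_sigmaWeakTopology (ξ η : H) :
    @Continuous _ ℂ (sigmaWeakTopology H) _ fun A : H →L[ℂ] H => inner ℂ ξ (A η) := by
  let _ := sigmaWeakTopology H
  simp_rw [← traceClassFunctional_single]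
  have htrace : Continuous fun (A : H →L[ℂ] H)
      (p : lp (fun _ : ℕ => H) 2 × lp (fun _ : ℕ => H) 2) => traceClassFunctional p.1 p.2 A :=
    continuous_induced_dom
  exact (continuous_pi_iff.mp htrace) (lp.single 2 0 ξ, lp.single 2 0 η)

variable [CompleteSpace H]

theorem isClosed_centralizer_sigmaWeakTopology (s : Set (H →L[ℂ] H)) :
    @IsClosed _ (sigmaWeakTopology H) s.centralizer := by
  let _ := sigmaWeakTopology H
  have hset : s.centralizer =
      ⋂ B ∈ s, ⋂ ξ : H, ⋂ η : H, {A | inner ℂ (B.adjoint ξ) (A η) = inner ℂ ξ (A (B η))} := by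
    ext A
    simp only [Set.mem_centralizer_iff, Set.mem_iInter, Set.mem_ofPred_eq]
    refine forall₂_congr fun B _ => ⟨fun h ξ η => ?_, fun h => ?_⟩
    · rw [ContinuousLinearMap.adjoint_inner_left, ← mul_apply_eq_comp, h, mul_apply_eq_comp]
    · refine ContinuousLinearMap.ext fun η => ext_inner_left ℂ fun ξ => ?_
      rw [mul_apply_eq_comp, mul_apply_eq_comp, ← h ξ η, ContinuousLinearMap.adjoint_inner_left]
  rw [hset]
  exact isClosed_biInter fun B _ => isClosed_iInter fun ξ => isClosed_iInter fun η =>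
    isClosed_eq (continuous_inner_sigmaWeakTopology _ _) (continuous_inner_sigmaWeakTopology _ _)

variable (M : VonNeumannAlgebra H)

/-- The normal functional `a ↦ ⟪ξ, a η⟫` on `M`. -/
noncomputable def vectorFunctional (ξ η : H) : M.toStarSubalgebra →ₗ[ℂ] ℂ :=
  (traceClassCLM (lp.single 2 0 ξ) (lp.single 2 0 η)).toLinearMap ∘ₗ
    M.toStarSubalgebra.toSubalgebra.val.toLinearMap

theorem isNormal_vectorFunctional (ξ η : H) : M.IsNormal (vectorFunctional M ξ η) :=
  ⟨_, _, fun _ => rfl⟩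

theorem vectorFunctional_apply (ξ η : H) (a : M.toStarSubalgebra) :
    vectorFunctional M ξ η a = inner ℂ ξ ((a : H →L[ℂ] H) η) :=
  traceClassFunctional_single ξ η a

end TraceClass

section Stinespring

/-! ### Radon–Nikodym derivatives of completely positive maps -/

theorem ofReal_norm_finsuppSum_sq {α E F : Type*} [Zero E] [NormedAddCommGroup F]
    [InnerProductSpace ℂ F] (c : α →₀ E) (W : α → E → F) :
    ((‖c.sum W‖ ^ 2 : ℝ) : ℂ) =
      c.sum fun x ξ => c.sum fun y η => inner ℂ (W x ξ) (W y η) := by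
  push_cast
  refine (inner_self_eq_norm_sq_to_K (𝕜 := ℂ) (c.sum W)).symm.trans ?_
  simp only [Finsupp.sum, sum_inner, inner_sum]
  exact Finset.sum_comm

theorem nonneg_iff_inner_nonneg {K : Type*} [NormedAddCommGroup K] [InnerProductSpace ℂ K]
    {A : K →L[ℂ] K} : 0 ≤ A ↔ ∀ k, 0 ≤ inner ℂ k (A k) := by
  rw [A.nonneg_iff_isPositive]
  refine ⟨fun h => h.inner_nonneg_right, fun h => A.isPositive_iff_complex.mpr fun k => ?_⟩
  have hk : 0 ≤ inner ℂ (A k) k := by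
    rw [← inner_conj_symm, starRingEnd_apply]
    exact star_nonneg_iff.mpr (h k)
  exact ⟨(Complex.eq_re_of_ofReal_le (r := 0) (by exact_mod_cast hk)).symm,
    (Complex.nonneg_iff.mp hk).1⟩

theorem mul_eq_zero_of_le_of_mul_eq_zero {A : Type*} [CStarAlgebra A] [PartialOrder A]
    [StarOrderedRing A] {a p q : A} (ha : 0 ≤ a) (hap : a ≤ p) (hpq : p * q = 0) : a * q = 0 := by
  obtain ⟨b, rfl⟩ := exists_star_mul_self_eq ha
  have hle : star (b * q) * (b * q) ≤ 0 := by
    simpa only [star_mul, mul_assoc, hpq, mul_zero] using star_left_conjugate_le_conjugate hap q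
  rw [mul_assoc, (CStarRing.star_mul_self_eq_zero_iff _).mp (hle.antisymm (star_mul_self_nonneg _)),
    mul_zero]

variable {X : Type*} [CStarAlgebra X] [PartialOrder X] [StarOrderedRing X]
  {H : Type*} [NormedAddCommGroup H] [InnerProductSpace ℂ H] [CompleteSpace H]
  {K : Type*} [NormedAddCommGroup K] [InnerProductSpace ℂ K] [CompleteSpace K]
  {M : VonNeumannAlgebra H}

theorem CPMap.le_iff_exists_add {T₁ T₂ : CPMap X M} :
    T₁ ≤ T₂ ↔ ∃ T' : CPMap X M, ∀ x, (T₂ x : H →L[ℂ] H) = T₁ x + T' x :=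
  exists_congr fun _ => forall_congr' fun _ => Subtype.ext_iff.trans sub_eq_iff_eq_add'

theorem CPMap.le_trans {T₁ T₂ T₃ : CPMap X M} (h₁₂ : T₁ ≤ T₂) (h₂₃ : T₂ ≤ T₃) : T₁ ≤ T₃ := by
  obtain ⟨A, hA⟩ := CPMap.le_iff_exists_add.mp h₁₂
  obtain ⟨B, hB⟩ := CPMap.le_iff_exists_add.mp h₂₃
  refine CPMap.le_iff_exists_add.mpr
    ⟨⟨⟨A.toLinearMap + B.toLinearMap, fun n a ha => ?_⟩, fun x => ?_⟩, fun x => ?_⟩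
  · exact add_nonneg (A.map_cstarMatrix_nonneg' n a ha) (B.map_cstarMatrix_nonneg' n a ha)
  · exact add_mem (A.map_mem' x) (B.map_mem' x)
  · rw [hB, hA, add_assoc]; rfl

namespace MinimalStinespring

variable {T : CPMap X M} (D : MinimalStinespring K T)

/-- The map `R ↦ V* R π(x) V` from `B(K)` to `B(H)`. -/
noncomputable def compress (x : X) : (K →L[ℂ] K) →L[ℂ] (H →L[ℂ] H) :=
  ContinuousLinearMap.compL ℂ H K H D.V.adjoint ∘L
    (ContinuousLinearMap.compL ℂ H K K).flip (D.π x ∘L D.V)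

theorem inner_compress (x : X) (R : K →L[ℂ] K) (ξ η : H) :
    inner ℂ ξ (D.compress x R η) = inner ℂ (D.V ξ) (R (D.π x (D.V η))) :=
  ContinuousLinearMap.adjoint_inner_right D.V ξ _

theorem inner_π_left (x : X) (k l : K) : inner ℂ (D.π x k) l = inner ℂ k (D.π (star x) l) := by
  rw [map_star, ContinuousLinearMap.star_eq_adjoint, ContinuousLinearMap.adjoint_inner_right]

theorem inner_of_commute {R : K →L[ℂ] K} (hR : ∀ x, Commute R (D.π x)) (x y : X) (ξ η : H) :
    inner ℂ (D.π x (D.V ξ)) (R (D.π y (D.V η))) = inner ℂ ξ (D.compress (star x * y) R η) := by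
  rw [inner_compress, inner_π_left, map_mul, mul_apply_eq_comp, ← mul_apply_eq_comp (D.π (star x)),
    ← (hR _).eq, mul_apply_eq_comp]

theorem compress_one (x : X) : D.compress x 1 = T x := (D.eq_compress x).symm

theorem inner_π (x y : X) (ξ η : H) :
    inner ℂ (D.π x (D.V ξ)) (D.π y (D.V η)) = inner ℂ ξ ((T (star x * y) : H →L[ℂ] H) η) := by
  rw [← D.compress_one, ← D.inner_of_commute fun x => Commute.one_left _, one_apply_eq_self]

/-- The linear combinations `∑ π(x) V c(x)` of the vectors spanning a dense subspace of `K`. -/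
noncomputable def combination : (X →₀ H) →ₗ[ℂ] K :=
  Finsupp.lsum ℂ fun x => (D.π x ∘L D.V).toLinearMap

theorem combination_single (x : X) (ξ : H) :
    D.combination (Finsupp.single x ξ) = D.π x (D.V ξ) := by
  simp [combination]

theorem combination_apply (c : X →₀ H) :
    D.combination c = c.sum fun x ξ => D.π x (D.V ξ) := by
  simp [combination, Function.comp_def]

theorem denseRange_combination : DenseRange D.combination := by
  have htop : (LinearMap.range D.combination).topologicalClosure = ⊤ := by
    rw [eq_top_iff, ← D.dense]
    refine Submodule.topologicalClosure_mono (Submodule.span_le.mpr ?_)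
    rintro k ⟨x, ξ, rfl⟩
    exact ⟨Finsupp.single x ξ, D.combination_single x ξ⟩
  exact Submodule.dense_iff_topologicalClosure_eq_top.mpr htop

theorem induction_on {p : K → Prop} (k : K) (hp : IsClosed {k | p k}) (hzero : p 0)
    (hadd : ∀ k l, p k → p l → p (k + l)) (hgen : ∀ x ξ, p (D.π x (D.V ξ))) : p k := by
  refine D.denseRange_combination.induction_on k hp fun c => ?_
  induction c using Finsupp.induction_linear with
  | zero => rwa [map_zero]
  | add f g hf hg => rw [map_add]; exact hadd _ _ hf hg
  | single x ξ => rw [combination_single]; exact hgen x ξ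

theorem eq_of_inner_eq {k l : K}
    (h : ∀ x ξ, inner ℂ (D.π x (D.V ξ)) k = inner ℂ (D.π x (D.V ξ)) l) : k = l :=
  ext_inner_left ℂ fun v => D.induction_on (p := fun v => inner ℂ v k = inner ℂ v l) v
    (isClosed_eq (by fun_prop) (by fun_prop)) (by rw [inner_zero_left, inner_zero_left])
    (fun v w hv hw => by rw [inner_add_left, inner_add_left, hv, hw]) h

theorem ext {A B : K →L[ℂ] K} (h : ∀ x ξ, A (D.π x (D.V ξ)) = B (D.π x (D.V ξ))) : A = B :=
  ContinuousLinearMap.ext fun k => D.induction_on (p := fun k => A k = B k) k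
    (isClosed_eq A.continuous B.continuous) (by rw [map_zero, map_zero])
    (fun k l hk hl => by rw [map_add, map_add, hk, hl]) h

theorem ext_inner {A B : K →L[ℂ] K}
    (h : ∀ x y ξ η, inner ℂ (D.π x (D.V ξ)) (A (D.π y (D.V η))) =
      inner ℂ (D.π x (D.V ξ)) (B (D.π y (D.V η)))) : A = B :=
  D.ext fun y η => D.eq_of_inner_eq fun x ξ => h x y ξ η

theorem ext_compress {A B : K →L[ℂ] K} (hA : ∀ x, Commute A (D.π x))
    (hB : ∀ x, Commute B (D.π x)) (h : ∀ x, D.compress x A = D.compress x B) : A = B :=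
  D.ext_inner fun x y ξ η => by rw [D.inner_of_commute hA, D.inner_of_commute hB, h]

theorem ofReal_norm_combination_sq (c : X →₀ H) :
    ((‖D.combination c‖ ^ 2 : ℝ) : ℂ) =
      c.sum fun x ξ => c.sum fun y η => inner ℂ ξ ((T (star x * y) : H →L[ℂ] H) η) := by
  rw [combination_apply, ofReal_norm_finsuppSum_sq]
  simp_rw [inner_π]

theorem exists_extension {F : Type*} [NormedAddCommGroup F] [InnerProductSpace ℂ F]
    [CompleteSpace F] (W : X → H →L[ℂ] F)
    (hW : ∀ c : X →₀ H, (c.sum fun x ξ => c.sum fun y η => inner ℂ (W x ξ) (W y η)) ≤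
      c.sum fun x ξ => c.sum fun y η => inner ℂ ξ ((T (star x * y) : H →L[ℂ] H) η)) :
    ∃ A : K →L[ℂ] F, ∀ x ξ, A (D.π x (D.V ξ)) = W x ξ := by
  let f : (X →₀ H) →ₗ[ℂ] F := Finsupp.lsum ℂ fun x => (W x).toLinearMap
  have hle : ∀ c, ‖f c‖ ≤ 1 * ‖D.combination c‖ := fun c => by
    have hf : f c = c.sum fun x ξ => W x ξ := by simp [f]
    have hsq := hW c
    rw [← ofReal_norm_finsuppSum_sq, ← hf, ← D.ofReal_norm_combination_sq] at hsq
    rw [one_mul]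
    exact le_of_sq_le_sq (by exact_mod_cast hsq) (norm_nonneg _)
  refine ⟨f.extendOfNorm D.combination, fun x ξ => ?_⟩
  rw [← D.combination_single, LinearMap.extendOfNorm_eq D.denseRange_combination ⟨1, hle⟩]
  simp [f]

/-- `R` is the Radon–Nikodym derivative of `T₁` with respect to `T`. -/
structure IsRNDerivative (R : K →L[ℂ] K) (T₁ : CPMap X M) : Prop where
  commute : ∀ x, Commute R (D.π x)
  compress_eq : ∀ x, D.compress x R = T₁ x

variable {D} {R R₁ R₂ : K →L[ℂ] K} {T₁ T₂ : CPMap X M}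

theorem isRNDerivative_one : D.IsRNDerivative 1 T :=
  ⟨fun _ => Commute.one_left _, D.compress_one⟩

namespace IsRNDerivative

theorem inner_eq (h : D.IsRNDerivative R T₁) (x y : X) (ξ η : H) :
    inner ℂ (D.π x (D.V ξ)) (R (D.π y (D.V η))) =
      inner ℂ ξ ((T₁ (star x * y) : H →L[ℂ] H) η) := by
  rw [D.inner_of_commute h.commute, h.compress_eq]

theorem eq (h₁ : D.IsRNDerivative R₁ T₁) (h₂ : D.IsRNDerivative R₂ T₁) : R₁ = R₂ :=
  D.ext_compress h₁.commute h₂.commute fun x => by rw [h₁.compress_eq, h₂.compress_eq]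

theorem nonneg (h : D.IsRNDerivative R T₁) : 0 ≤ R := by
  refine nonneg_iff_inner_nonneg.mpr fun k => ?_
  refine D.denseRange_combination.induction_on k
    (isClosed_le continuous_const (by fun_prop)) fun c => ?_
  have hsum : inner ℂ (D.combination c) (R (D.combination c)) =
      c.sum fun x ξ => c.sum fun y η => inner ℂ ξ ((T₁ (star x * y) : H →L[ℂ] H) η) := by
    simp_rw [← h.inner_eq, D.combination_apply, Finsupp.sum, map_sum, sum_inner, inner_sum]
  exact (sum_inner_star_mul_nonneg T₁.toCompletelyPositiveMap c).trans_eq hsum.symm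

theorem sub (h₁ : D.IsRNDerivative R₁ T₁) (h₂ : D.IsRNDerivative R₂ T₂) {T' : CPMap X M}
    (hT' : ∀ x, (T₂ x : H →L[ℂ] H) = T₁ x + T' x) : D.IsRNDerivative (R₂ - R₁) T' where
  commute x := (h₂.commute x).sub_left (h₁.commute x)
  compress_eq x := by rw [map_sub, h₁.compress_eq, h₂.compress_eq, hT', add_sub_cancel_left]

theorem le_of_le (h₁ : D.IsRNDerivative R₁ T₁) (h₂ : D.IsRNDerivative R₂ T₂) (h : T₁ ≤ T₂) :
    R₁ ≤ R₂ :=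
  let ⟨_, hT'⟩ := CPMap.le_iff_exists_add.mp h
  sub_nonneg.mp (h₁.sub h₂ hT').nonneg

end IsRNDerivative

variable (D) in
theorem exists_isRNDerivative (h : T₁ ≤ T) : ∃ R : K →L[ℂ] K, D.IsRNDerivative R T₁ := by
  obtain ⟨T₂, hT₂⟩ := CPMap.le_iff_exists_add.mp h
  obtain ⟨k, _, W, hW⟩ := exists_kolmogorov_decomposition T₁.toCompletelyPositiveMap
  obtain ⟨A, hA⟩ := D.exists_extension W fun c => by
    have hsplit : (c.sum fun x ξ => c.sum fun y η =>
        inner ℂ ξ ((T (star x * y) : H →L[ℂ] H) η)) =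
        (c.sum fun x ξ => c.sum fun y η => inner ℂ (W x ξ) (W y η)) +
        c.sum fun x ξ => c.sum fun y η => inner ℂ ξ ((T₂ (star x * y) : H →L[ℂ] H) η) := by
      rw [← Finsupp.sum_add]
      refine Finsupp.sum_congr fun x _ => ?_
      rw [← Finsupp.sum_add]
      refine Finsupp.sum_congr fun y _ => ?_
      rw [hT₂, add_apply, inner_add_right, hW]
      rfl
    rw [hsplit]
    exact le_add_of_nonneg_right (sum_inner_star_mul_nonneg T₂.toCompletelyPositiveMap c)
  have hinner : ∀ x y ξ η, inner ℂ (D.π x (D.V ξ)) ((A.adjoint ∘L A) (D.π y (D.V η))) =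
      inner ℂ ξ ((T₁ (star x * y) : H →L[ℂ] H) η) := fun x y ξ η => by
    rw [ContinuousLinearMap.comp_apply, ContinuousLinearMap.adjoint_inner_right, hA, hA, hW]
    rfl
  have hcomm : ∀ x, Commute (A.adjoint ∘L A) (D.π x) := fun x => D.ext_inner fun y z ξ η => by
    rw [mul_apply_eq_comp, mul_apply_eq_comp, ← mul_apply_eq_comp (D.π x) (D.π z), ← map_mul,
      hinner, ← star_star x, ← D.inner_π_left, ← mul_apply_eq_comp (D.π _) (D.π y), ← map_mul,
      hinner, star_mul, star_star, mul_assoc]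
  refine ⟨A.adjoint ∘L A, hcomm, fun x => ?_⟩
  refine ContinuousLinearMap.ext fun η => ext_inner_left ℂ fun ξ => ?_
  have h1 := hinner 1 x ξ η
  rwa [D.inner_of_commute hcomm, star_one, one_mul] at h1

end MinimalStinespring

end Stinespring

section RelativeCommutant

/-! ### The relative commutant -/

section StarSubalgebra

variable {A : Type*} [CStarAlgebra A] [PartialOrder A] [StarOrderedRing A]
  {N : StarSubalgebra ℂ A} {a : A}

theorem mem_span_nonneg_le_one_of_isSelfAdjoint (ha : IsSelfAdjoint a) (haN : a ∈ N) :
    a ∈ Submodule.span ℂ {b | b ∈ N ∧ 0 ≤ b ∧ b ≤ 1} := by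
  obtain ⟨c, hc, hac⟩ : ∃ c : ℝ, 0 < c ∧ ‖a‖ ≤ c :=
    ⟨‖a‖ + 1, by positivity, le_add_of_nonneg_right zero_le_one⟩
  have hle : algebraMap ℝ A ‖a‖ ≤ c • 1 := by
    rw [← Algebra.algebraMap_eq_smul_one]
    exact algebraMap_mono A hac
  have hlower : 0 ≤ a + c • 1 :=
    neg_le_iff_add_nonneg.mp ((neg_le_neg hle).trans ha.neg_algebraMap_norm_le_self)
  have hupper : a + c • 1 ≤ (2 * c) • 1 := by
    rw [two_mul, add_smul]
    exact add_le_add_left (ha.le_algebraMap_norm_self.trans hle) _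
  let b : A := (2 * c)⁻¹ • (a + c • 1)
  have hbN : b ∈ N := by
    simp only [b, ← Complex.coe_smul]
    exact N.smul_mem (add_mem haN (N.smul_mem (one_mem N) _)) _
  have hb : b ∈ {b | b ∈ N ∧ 0 ≤ b ∧ b ≤ 1} :=
    ⟨hbN, smul_nonneg (by positivity) hlower, (inv_smul_le_iff_of_pos (by positivity)).mpr hupper⟩
  have hab : a = ((2 * c : ℝ) : ℂ) • b - (c : ℂ) • 1 := by
    rw [Complex.coe_smul, Complex.coe_smul, smul_inv_smul₀ (by positivity), add_sub_cancel_right]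
  rw [hab]
  exact sub_mem (Submodule.smul_mem _ _ (Submodule.subset_span hb))
    (Submodule.smul_mem _ _ (Submodule.subset_span ⟨one_mem N, zero_le_one, le_rfl⟩))

theorem mem_span_nonneg_le_one (ha : a ∈ N) :
    a ∈ Submodule.span ℂ {b | b ∈ N ∧ 0 ≤ b ∧ b ≤ 1} := by
  have hre : (realPart a : A) ∈ N := by
    rw [realPart_apply_coe, ← Complex.coe_smul]
    exact N.smul_mem (add_mem ha (star_mem ha)) _
  have him : (imaginaryPart a : A) ∈ N := by
    rw [imaginaryPart_apply_coe, ← Complex.coe_smul]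
    exact N.smul_mem (N.smul_mem (sub_mem ha (star_mem ha)) _) _
  rw [← realPart_add_I_smul_imaginaryPart a]
  exact add_mem (mem_span_nonneg_le_one_of_isSelfAdjoint (realPart a).2 hre)
    (Submodule.smul_mem _ _ (mem_span_nonneg_le_one_of_isSelfAdjoint (imaginaryPart a).2 him))

end StarSubalgebra

variable {X : Type*} [CStarAlgebra X] [PartialOrder X] [StarOrderedRing X]
  {H : Type*} [NormedAddCommGroup H] [InnerProductSpace ℂ H] [CompleteSpace H]
  {K : Type*} [NormedAddCommGroup K] [InnerProductSpace ℂ K] [CompleteSpace K]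
  {M : VonNeumannAlgebra H}

theorem isClosed_vonNeumannAlgebra (M : VonNeumannAlgebra H) : IsClosed (M : Set (H →L[ℂ] H)) := by
  rw [← M.centralizer_centralizer]
  exact Set.isClosed_centralizer _

namespace MinimalStinespring

variable {T : CPMap X M} (D : MinimalStinespring K T)

/-- `W` is the lift to `K` of an operator `u` on `H` (in practice `u ∈ M'`), that is,
`W π(x) V = π(x) V u` for all `x`. -/
def IsLift (u : H →L[ℂ] H) (W : K →L[ℂ] K) : Prop :=
  ∀ x ξ, W (D.π x (D.V ξ)) = D.π x (D.V (u ξ))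

theorem inner_π_apply_right {u : H →L[ℂ] H} (hu : u ∈ M.commutant) (x y : X) (ξ η : H) :
    inner ℂ (D.π x (D.V ξ)) (D.π y (D.V (u η))) =
      inner ℂ (D.π x (D.V (star u ξ))) (D.π y (D.V η)) := by
  rw [D.inner_π, D.inner_π, ContinuousLinearMap.star_eq_adjoint,
    ContinuousLinearMap.adjoint_inner_left, ← mul_apply_eq_comp, ← mul_apply_eq_comp,
    VonNeumannAlgebra.mem_commutant_iff.mp hu _ (T (star x * y)).2]

theorem exists_isLift_of_star_mul_self {u : H →L[ℂ] H} (hu : u ∈ M.commutant)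
    (huu : star u * u = 1) : ∃ W : K →L[ℂ] K, D.IsLift u W := by
  refine D.exists_extension (fun x => D.π x ∘L D.V ∘L u) fun c =>
    le_of_eq <| Finsupp.sum_congr fun x _ => Finsupp.sum_congr fun y _ => ?_
  refine (D.inner_π_apply_right hu x y (u (c x)) (c y)).trans ?_
  rw [← mul_apply_eq_comp, huu, one_apply_eq_self, D.inner_π]

theorem exists_isLift {u : H →L[ℂ] H} (hu : u ∈ M.commutant) :
    ∃ W : K →L[ℂ] K, D.IsLift u W := by
  have : IsClosed (M.commutant.toStarSubalgebra : Set (H →L[ℂ] H)) :=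
    isClosed_vonNeumannAlgebra M.commutant
  obtain ⟨v, c, huv, -⟩ :=
    CStarAlgebra.exists_sum_four_unitary (⟨u, hu⟩ : M.commutant.toStarSubalgebra)
  replace huv : u = ∑ i, c i • ((v i : M.commutant.toStarSubalgebra) : H →L[ℂ] H) := by
    simpa using congrArg Subtype.val huv
  choose W hW using fun i => D.exists_isLift_of_star_mul_self (v i).1.2
    (congrArg Subtype.val (Unitary.star_mul_self_of_mem (v i).2))
  refine ⟨∑ i, c i • W i, fun x ξ => ?_⟩
  simp only [huv, sum_apply, smul_apply, map_sum, map_smul, hW _ x ξ]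

variable {D} {R R₁ R₂ : K →L[ℂ] K} {T₁ T₂ : CPMap X M}

theorem IsLift.adjoint {u : H →L[ℂ] H} {W : K →L[ℂ] K} (hW : D.IsLift u W) (hu : u ∈ M.commutant) :
    D.IsLift (star u) (star W) := fun x ξ => by
  refine ext_inner_right ℂ fun k => ?_
  rw [ContinuousLinearMap.star_eq_adjoint W, ContinuousLinearMap.adjoint_inner_left]
  refine D.induction_on
    (p := fun k => inner ℂ (D.π x (D.V ξ)) (W k) = inner ℂ (D.π x (D.V (star u ξ))) k) k
    (isClosed_eq (by fun_prop) (by fun_prop)) (by simp only [map_zero, inner_zero_right])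
    (fun k l hk hl => by rw [map_add, inner_add_right, inner_add_right, hk, hl]) fun y η => ?_
  rw [hW, D.inner_π_apply_right hu]

theorem IsLift.commute_iff {u : H →L[ℂ] H} {W : K →L[ℂ] K} (hW : D.IsLift u W)
    (hu : u ∈ M.commutant) (hR : ∀ x, Commute R (D.π x)) :
    Commute W R ↔ ∀ x, Commute u (D.compress x R) := by
  have hWR : ∀ x y ξ η, inner ℂ (D.π x (D.V ξ)) ((W * R) (D.π y (D.V η))) =
      inner ℂ ξ ((u * D.compress (star x * y) R) η) := fun x y ξ η => by
    rw [mul_apply_eq_comp, ← ContinuousLinearMap.adjoint_inner_left,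
      ← ContinuousLinearMap.star_eq_adjoint, hW.adjoint hu, D.inner_of_commute hR,
      mul_apply_eq_comp, ContinuousLinearMap.star_eq_adjoint,
      ContinuousLinearMap.adjoint_inner_left]
  have hRW : ∀ x y ξ η, inner ℂ (D.π x (D.V ξ)) ((R * W) (D.π y (D.V η))) =
      inner ℂ ξ ((D.compress (star x * y) R * u) η) := fun x y ξ η => by
    rw [mul_apply_eq_comp, hW, D.inner_of_commute hR, mul_apply_eq_comp]
  refine ⟨fun h x => ?_, fun h => D.ext_inner fun x y ξ η => ?_⟩
  · refine ContinuousLinearMap.ext fun η => ext_inner_left ℂ fun ξ => ?_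
    have h1 := hWR 1 x ξ η
    rw [h.eq, hRW, star_one, one_mul] at h1
    exact h1.symm
  · rw [hWR, hRW, (h _).eq]

variable (D) in
/-- The commutant of `π(X)` and of the lifts of `M'`. It turns out to be the relative commutant, and
this description makes visible that the latter is a von Neumann algebra. -/
noncomputable def liftCommutant : StarSubalgebra ℂ (K →L[ℂ] K) :=
  StarSubalgebra.centralizer ℂ (Set.range D.π ∪ {W | ∃ u ∈ M.commutant, D.IsLift u W})

theorem mem_liftCommutant_iff :
    R ∈ D.liftCommutant ↔
      (∀ x, Commute R (D.π x)) ∧ ∀ x, D.compress x R ∈ M.toStarSubalgebra := by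
  rw [liftCommutant, StarSubalgebra.mem_centralizer_iff]
  constructor
  · intro h
    have hR : ∀ x, Commute R (D.π x) := fun x => (h (D.π x) (.inl ⟨x, rfl⟩)).1.symm
    refine ⟨hR, fun x => ?_⟩
    have hmem : D.compress x R ∈ M.commutant.commutant :=
      VonNeumannAlgebra.mem_commutant_iff.mpr fun u hu =>
        let ⟨W, hW⟩ := D.exists_isLift hu
        (hW.commute_iff hu hR).mp (h W (.inr ⟨u, hu, hW⟩)).1 x
    rwa [M.commutant_commutant] at hmem
  · rintro ⟨hR, hRM⟩ _ (⟨x, rfl⟩ | ⟨u, hu, hW⟩)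
    · rw [← map_star]
      exact ⟨(hR x).symm, (hR (star x)).symm⟩
    · have commute_lift : ∀ {v W}, v ∈ M.commutant → D.IsLift v W → Commute W R :=
        fun hv hW => (hW.commute_iff hv hR).mpr fun x =>
          (VonNeumannAlgebra.mem_commutant_iff.mp hv _ (hRM x)).symm
      exact ⟨commute_lift hu hW, commute_lift (star_mem hu) (hW.adjoint hu)⟩

theorem isClosed_liftCommutant : IsClosed (D.liftCommutant : Set (K →L[ℂ] K)) :=
  Set.isClosed_centralizer _

theorem IsRNDerivative.mem_liftCommutant (h : D.IsRNDerivative R T₁) : R ∈ D.liftCommutant :=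
  mem_liftCommutant_iff.mpr ⟨h.commute, fun x => h.compress_eq x ▸ (T₁ x).2⟩

theorem exists_isRNDerivative_of_nonneg (hR : R ∈ D.liftCommutant) (hR0 : 0 ≤ R) :
    ∃ T' : CPMap X M, D.IsRNDerivative R T' := by
  obtain ⟨hRπ, hRM⟩ := mem_liftCommutant_iff.mp hR
  obtain ⟨Φ, hΦ⟩ := exists_completelyPositiveMap_compress D.π D.V hR0 hRπ
  refine ⟨⟨Φ, fun x => ?_⟩, hRπ, fun x => (hΦ x).symm⟩
  have hx : Φ x = D.compress x R := hΦ x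
  exact (congrArg (· ∈ M.toStarSubalgebra) hx).mpr (hRM x)

theorem IsRNDerivative.le_iff (h₁ : D.IsRNDerivative R₁ T₁) (h₂ : D.IsRNDerivative R₂ T₂) :
    T₁ ≤ T₂ ↔ R₁ ≤ R₂ := by
  refine ⟨h₁.le_of_le h₂, fun h => ?_⟩
  obtain ⟨T', hT'⟩ := exists_isRNDerivative_of_nonneg
    (sub_mem h₂.mem_liftCommutant h₁.mem_liftCommutant) (sub_nonneg.mpr h)
  refine CPMap.le_iff_exists_add.mpr ⟨T', fun x => ?_⟩
  rw [← hT'.compress_eq, map_sub, h₁.compress_eq, h₂.compress_eq, add_sub_cancel]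

theorem relCommutant_eq_liftCommutant : D.relCommutant = D.liftCommutant := by
  apply subset_antisymm
  · refine @closure_minimal _ (sigmaWeakTopology K) _ _ ?_
      (isClosed_centralizer_sigmaWeakTopology _)
    refine (Submodule.span_le (p := D.liftCommutant.toSubalgebra.toSubmodule)).mpr ?_
    rintro R ⟨hR, -, -, T', hT'⟩
    exact IsRNDerivative.mem_liftCommutant
      ⟨fun x => (hR (D.π x) ⟨x, rfl⟩).symm, fun x => (hT' x).symm⟩
  · intro R hR
    refine @subset_closure _ (sigmaWeakTopology K) _ _
      (Submodule.span_mono ?_ (mem_span_nonneg_le_one hR))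
    rintro Q ⟨hQ, hQ0, hQ1⟩
    obtain ⟨T', hT'⟩ := exists_isRNDerivative_of_nonneg hQ hQ0
    refine ⟨?_, hQ0, hQ1, T', fun x => (hT'.compress_eq x).symm⟩
    rintro _ ⟨x, rfl⟩
    exact (hT'.commute x).symm

theorem orthogonal_iff_mul_self (h₁ : D.IsRNDerivative R T₁) (h₂ : D.IsRNDerivative (1 - R) T₂) :
    T₁.Orthogonal T₂ ↔ R * R = R := by
  have mul_one_sub_eq_zero_iff : R * (1 - R) = 0 ↔ R * R = R := by
    rw [mul_sub, mul_one, sub_eq_zero, eq_comm]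
  rw [← mul_one_sub_eq_zero_iff]
  constructor
  · intro horth
    have hcomm : Commute R (1 - R) := (Commute.one_right R).sub_right (Commute.refl R)
    obtain ⟨T', hT'⟩ := exists_isRNDerivative_of_nonneg
      (mul_mem h₁.mem_liftCommutant h₂.mem_liftCommutant) (hcomm.mul_nonneg h₁.nonneg h₂.nonneg)
    have hle₁ : R * (1 - R) ≤ R := by
      have := (h₁.nonneg.isSelfAdjoint.mul_self_nonneg)
      rwa [mul_sub, mul_one, sub_le_self_iff]
    have hle₂ : R * (1 - R) ≤ 1 - R := by
      have := (h₂.nonneg.isSelfAdjoint.mul_self_nonneg)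
      rwa [sub_mul, one_mul, sub_nonneg] at this
    have hzero := horth T' ((hT'.le_iff h₁).mpr hle₁) ((hT'.le_iff h₂).mpr hle₂)
    exact D.ext_compress hT'.commute (fun x => Commute.zero_left _) fun x => by
      rw [hT'.compress_eq, hzero, map_zero]; rfl
  · intro hmul T' hT'₁ hT'₂ x
    have hT₁ : T₁ ≤ T := (h₁.le_iff isRNDerivative_one).mpr (sub_nonneg.mp h₂.nonneg)
    obtain ⟨R', hR'⟩ := D.exists_isRNDerivative (CPMap.le_trans hT'₁ hT₁)
    have hR'₁ : R' * (1 - R) = 0 :=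
      mul_eq_zero_of_le_of_mul_eq_zero hR'.nonneg (hR'.le_of_le h₁ hT'₁) hmul
    have hR'₂ : R' * R = 0 :=
      mul_eq_zero_of_le_of_mul_eq_zero hR'.nonneg (hR'.le_of_le h₂ hT'₂)
        (by rw [sub_mul, one_mul, mul_one_sub_eq_zero_iff.mp hmul, sub_self])
    have hR'0 : R' = 0 := by rw [← mul_one R', ← sub_add_cancel 1 R, mul_add, hR'₁, hR'₂, add_zero]
    refine Subtype.ext ?_
    rw [← hR'.compress_eq, hR'0, map_zero]; rfl

end MinimalStinespring
end RelativeCommutant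

section EssentiallyBounded

/-! ### Essentially bounded functions -/

theorem exists_simpleFunc_dist_le {S α : Type*} [MeasurableSpace S] [PseudoMetricSpace α]
    [TopologicalSpace.SeparableSpace α] [Nonempty α] [MeasurableSpace α] [OpensMeasurableSpace α]
    {g : S → α} (hg : Measurable g) {t : Set α} (ht : IsCompact t) {ε : ℝ} (hε : 0 < ε) :
    ∃ f : SimpleFunc S α, ∀ s, g s ∈ t → dist (g s) (f s) ≤ ε := by
  let e := TopologicalSpace.denseSeq α
  obtain ⟨F, hF⟩ := ht.elim_finite_subcover (fun n => Metric.ball (e n) ε)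
    (fun n => Metric.isOpen_ball) fun z _ =>
      let ⟨n, hn⟩ := (TopologicalSpace.denseRange_denseSeq α).exists_dist_lt z hε
      Set.mem_iUnion.mpr ⟨n, Metric.mem_ball.mpr hn⟩
  obtain ⟨N, hN⟩ := F.exists_le
  refine ⟨(SimpleFunc.nearestPt e N).comp g hg, fun s hs => ?_⟩
  obtain ⟨n, hnF, hn⟩ := Set.mem_iUnion₂.mp (hF hs)
  have hnearest := SimpleFunc.edist_nearestPt_le e (g s) (hN n hnF)
  rw [edist_dist, edist_dist, ENNReal.ofReal_le_ofReal_iff dist_nonneg] at hnearest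
  rw [dist_comm]
  exact hnearest.trans ((dist_comm _ _).trans_le (Metric.mem_ball.mp hn).le)

variable {S : Type*} [MeasurableSpace S] {ν : Measure S}

theorem ae_norm_le_norm_of_Linfty {E : Type*} [NormedAddCommGroup E] (f : Lp E ∞ ν) :
    ∀ᵐ s ∂ν, ‖f s‖ ≤ ‖f‖ := by
  filter_upwards [ae_le_eLpNormEssSup (f := f) (μ := ν)] with s hs
  rw [Lp.norm_def, eLpNorm_exponent_top, ← toReal_enorm]
  exact ENNReal.toReal_mono (eLpNorm_exponent_top (f := f) ▸ Lp.eLpNorm_ne_top f) hs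

theorem norm_Linfty_le_of_ae_bound {E : Type*} [NormedAddCommGroup E] {f : Lp E ∞ ν} {C : ℝ}
    (hC : 0 ≤ C) (h : ∀ᵐ s ∂ν, ‖f s‖ ≤ C) : ‖f‖ ≤ C := by
  rw [Lp.norm_def, eLpNorm_exponent_top]
  exact ENNReal.toReal_le_of_le_ofReal hC (eLpNormEssSup_le_of_ae_bound h)

variable (ν) in
/-- The class in `L^∞(ν)` of a simple function. -/
noncomputable def simpleToLinfty : SimpleFunc S ℂ →ₗ[ℂ] Lp ℂ ∞ ν where
  toFun f := (f.memLp_top ν).toLp f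
  map_add' _ _ := rfl
  map_smul' _ _ := rfl

theorem coeFn_simpleToLinfty (f : SimpleFunc S ℂ) : simpleToLinfty ν f =ᵐ[ν] f :=
  MemLp.coeFn_toLp (f.memLp_top ν)

theorem denseRange_simpleToLinfty : DenseRange (simpleToLinfty ν) := by
  intro g
  rw [Metric.mem_closure_iff]
  intro ε hε
  obtain ⟨f, hf⟩ := exists_simpleFunc_dist_le (Lp.stronglyMeasurable g).measurable
    (isCompact_closedBall 0 ‖g‖) (half_pos hε)
  refine ⟨_, ⟨f, rfl⟩, ?_⟩
  rw [dist_eq_norm]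
  refine lt_of_le_of_lt (norm_Linfty_le_of_ae_bound (half_pos hε).le ?_) (half_lt_self hε)
  filter_upwards [Lp.coeFn_sub g (simpleToLinfty ν f), coeFn_simpleToLinfty (ν := ν) f,
    ae_norm_le_norm_of_Linfty g] with s hsub hsimple hbound
  rw [hsub, Pi.sub_apply, hsimple, ← dist_eq_norm]
  exact hf s (mem_closedBall_zero_iff.mpr hbound)

theorem star_add_Linfty (f g : Lp ℂ ∞ ν) : star (f + g) = star f + star g := by
  refine Lp.ext ?_
  filter_upwards [Lp.coeFn_star (f + g), Lp.coeFn_add f g, Lp.coeFn_add (star f) (star g),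
    Lp.coeFn_star f, Lp.coeFn_star g] with s hstar_add hadd hadd_star hf hg
  rw [hstar_add, hadd_star, Pi.star_apply, hadd, Pi.add_apply, Pi.add_apply, hf, hg, star_add]
  rfl

theorem norm_star_Linfty_le (f : Lp ℂ ∞ ν) : ‖star f‖ ≤ ‖f‖ := by
  refine norm_Linfty_le_of_ae_bound (norm_nonneg _) ?_
  filter_upwards [Lp.coeFn_star f, ae_norm_le_norm_of_Linfty f] with s hstar hbound
  rwa [hstar, Pi.star_apply, norm_star]

theorem continuous_star_Linfty : Continuous fun f : Lp ℂ ∞ ν => star f :=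
  AddMonoidHomClass.continuous_of_bound (AddMonoidHom.mk' star star_add_Linfty) 1 fun f => by
    rw [one_mul]
    exact norm_star_Linfty_le f

theorem measurableSet_support_Linfty (f : Lp ℂ ∞ ν) : MeasurableSet {s | f s ≠ 0} :=
  (Lp.stronglyMeasurable f).measurable (measurableSet_singleton 0).compl

theorem smul_comm_Linfty (f g : Lp ℂ ∞ ν) : (f • g : Lp ℂ ∞ ν) = g • f := by
  refine Lp.ext ?_
  filter_upwards [Lp.coeFn_lpSMul (r := ∞) f g, Lp.coeFn_lpSMul (r := ∞) g f] with s hfg hgf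
  rw [hfg, hgf, Pi.smul_apply', Pi.smul_apply', smul_eq_mul, smul_eq_mul, mul_comm]

theorem continuous_smul_right_Linfty (f : Lp ℂ ∞ ν) :
    Continuous fun g : Lp ℂ ∞ ν => (f • g : Lp ℂ ∞ ν) :=
  AddMonoidHomClass.continuous_of_bound
    (AddMonoidHom.mk' (fun g : Lp ℂ ∞ ν => (f • g : Lp ℂ ∞ ν)) fun g g' => Lp.add_smul f g g') ‖f‖
    fun g => Lp.norm_smul_le f g

section Integral

variable {m : Measure S} [IsFiniteMeasure m] (hm : m ≪ ν)

include hm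

theorem integrable_Linfty (f : Lp ℂ ∞ ν) : Integrable f m :=
  .of_bound ((Lp.aestronglyMeasurable f).mono_ac hm) ‖f‖ (hm.ae_le (ae_norm_le_norm_of_Linfty f))

theorem integral_add_Linfty (f g : Lp ℂ ∞ ν) :
    ∫ s, (f + g : Lp ℂ ∞ ν) s ∂m = ∫ s, f s ∂m + ∫ s, g s ∂m := by
  rw [← integral_add (integrable_Linfty hm f) (integrable_Linfty hm g)]
  exact integral_congr_ae (hm.ae_le (Lp.coeFn_add f g))

theorem continuous_integral_Linfty : Continuous fun f : Lp ℂ ∞ ν => ∫ s, f s ∂m :=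
  AddMonoidHomClass.continuous_of_bound
    (AddMonoidHom.mk' (fun f : Lp ℂ ∞ ν => ∫ s, f s ∂m) (integral_add_Linfty hm)) (m.real Set.univ)
    fun f => by
      rw [mul_comm]
      exact norm_integral_le_of_norm_le_const (hm.ae_le (ae_norm_le_norm_of_Linfty f))

end Integral

variable [IsFiniteMeasure ν]

variable (ν) in
/-- The class in `L^∞(ν)` of the function with value `c` on `Δ` and `0` elsewhere. -/
noncomputable abbrev indicatorLinfty {Δ : Set S} (hΔ : MeasurableSet Δ) (c : ℂ) : Lp ℂ ∞ ν :=
  indicatorConstLp ∞ hΔ (measure_ne_top ν Δ) c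

theorem coeFn_indicatorLinfty {Δ : Set S} (hΔ : MeasurableSet Δ) (c : ℂ) :
    indicatorLinfty ν hΔ c =ᵐ[ν] Δ.indicator fun _ => c :=
  indicatorConstLp_coeFn

theorem Linfty_induction {p : Lp ℂ ∞ ν → Prop} (f : Lp ℂ ∞ ν) (hp : IsClosed {f | p f})
    (hadd : ∀ f g, p f → p g → p (f + g))
    (hind : ∀ (Δ : Set S) (hΔ : MeasurableSet Δ) (c : ℂ), p (indicatorLinfty ν hΔ c)) : p f := by
  refine denseRange_simpleToLinfty.induction_on f hp fun f => ?_
  induction f using SimpleFunc.induction with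
  | const c hΔ => exact hind _ hΔ c
  | add _ hf hg => exact map_add (simpleToLinfty ν) _ _ ▸ hadd _ _ hf hg

theorem star_indicatorLinfty {Δ : Set S} (hΔ : MeasurableSet Δ) (c : ℂ) :
    star (indicatorLinfty ν hΔ c) = indicatorLinfty ν hΔ (star c) := by
  refine Lp.ext ?_
  filter_upwards [Lp.coeFn_star (indicatorLinfty ν hΔ c), coeFn_indicatorLinfty hΔ c,
    coeFn_indicatorLinfty hΔ (star c)] with s hstar hc hsc
  rw [hstar, hsc, Pi.star_apply, hc]
  exact congrFun (Set.comp_indicator_const c star (star_zero ℂ)) s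

theorem indicatorLinfty_smul {Δ Δ' : Set S} (hΔ : MeasurableSet Δ) (hΔ' : MeasurableSet Δ')
    (c c' : ℂ) :
    (indicatorLinfty ν hΔ c • indicatorLinfty ν hΔ' c' : Lp ℂ ∞ ν) =
      indicatorLinfty ν (hΔ.inter hΔ') (c * c') := by
  refine Lp.ext ?_
  filter_upwards [Lp.coeFn_lpSMul (r := ∞) (indicatorLinfty ν hΔ c) (indicatorLinfty ν hΔ' c'),
    coeFn_indicatorLinfty hΔ c, coeFn_indicatorLinfty hΔ' c',
    coeFn_indicatorLinfty (hΔ.inter hΔ') (c * c')] with s hsmul hc hc' hcc'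
  rw [hsmul, hcc', Pi.smul_apply', hc, hc', smul_eq_mul, Set.inter_indicator_mul]

end EssentiallyBounded

section PositiveOperatorValuedMeasure

/-! ### Positive operator valued measures -/

variable {K : Type*} [NormedAddCommGroup K] [InnerProductSpace ℂ K]
  {S : Type*} [MeasurableSpace S]

theorem norm_sum_smul_le [CompleteSpace K] {ι : Type*} {t : Finset ι} {A : ι → K →L[ℂ] K}
    (hA : ∀ i ∈ t, 0 ≤ A i) (hsum : ∑ i ∈ t, A i = 1) {c : ι → ℂ} {C : ℝ} (hC : 0 ≤ C)
    (hc : ∀ i ∈ t, A i ≠ 0 → ‖c i‖ ≤ C) : ‖∑ i ∈ t, c i • A i‖ ≤ C := by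
  choose! b hb using fun i hi => exists_star_mul_self_eq (hA i hi)
  have hinner : ∀ i ∈ t, ∀ k l, inner ℂ k (A i l) = inner ℂ (b i k) (b i l) := fun i hi k l => by
    rw [← hb i hi, mul_apply_eq_comp, ContinuousLinearMap.star_eq_adjoint,
      ContinuousLinearMap.adjoint_inner_right]
  have hnorm : ∀ k, ‖k‖ = 1 → ∑ i ∈ t, ‖b i k‖ ^ 2 = 1 := fun k hk => by
    have hre : RCLike.re (inner ℂ k ((∑ i ∈ t, A i) k)) = 1 := by
      rw [hsum, one_apply_eq_self, ← norm_sq_eq_re_inner, hk, one_pow]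
    rw [← hre, sum_apply, inner_sum, map_sum]
    exact Finset.sum_congr rfl fun i hi => by rw [hinner i hi, norm_sq_eq_re_inner (𝕜 := ℂ)]
  have hterm : ∀ i ∈ t, ∀ k l, ‖inner ℂ k ((c i • A i) l)‖ ≤ C * (‖b i k‖ * ‖b i l‖) := by
    intro i hi k l
    by_cases hzero : A i = 0
    · simpa only [hzero, smul_zero, zero_apply, inner_zero_right, norm_zero] using by positivity
    · rw [smul_apply, inner_smul_right, norm_mul, hinner i hi]
      gcongr
      exacts [hc i hi hzero, norm_inner_le_norm _ _]
  refine ContinuousLinearMap.opNorm_le_of_re_inner_le hC fun l k hl hk => ?_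
  rw [inner_re_symm, sum_apply, inner_sum]
  calc _ ≤ ‖∑ i ∈ t, inner ℂ k ((c i • A i) l)‖ := RCLike.re_le_norm _
    _ ≤ ∑ i ∈ t, C * (‖b i k‖ * ‖b i l‖) :=
        norm_sum_le_of_le t fun i hi => hterm i hi k l
    _ ≤ C * (√(∑ i ∈ t, ‖b i k‖ ^ 2) * √(∑ i ∈ t, ‖b i l‖ ^ 2)) := by
        rw [← Finset.mul_sum]
        gcongr
        exact Real.sum_mul_le_sqrt_mul_sqrt _ _ _
    _ = C := by rw [hnorm k hk, hnorm l hl, Real.sqrt_one, mul_one, mul_one]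

/-- `P` is a weakly `σ`-additive positive operator valued measure on `S` with `P(S) = 1`, vanishing
on the null sets of `ν`. Only its values on measurable sets are meaningful. -/
structure IsPOVM (ν : Measure S) (P : Set S → K →L[ℂ] K) : Prop where
  nonneg : ∀ Δ, MeasurableSet Δ → 0 ≤ P Δ
  univ : P Set.univ = 1
  null : ∀ Δ, MeasurableSet Δ → ν Δ = 0 → P Δ = 0
  hasSum_inner : ∀ Δ : ℕ → Set S, (∀ i, MeasurableSet (Δ i)) → Pairwise (Disjoint on Δ) →
    ∀ k l : K, HasSum (fun i => inner ℂ k (P (Δ i) l)) (inner ℂ k (P (⋃ i, Δ i) l))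

/-- The map `c ↦ c P(Δ)`, as the vector measure that `SimpleFunc.setToSimpleFunc` integrates. -/
noncomputable def smulWeight (P : Set S → K →L[ℂ] K) (Δ : Set S) : ℂ →L[ℝ] (K →L[ℂ] K) :=
  ((ContinuousLinearMap.id ℂ ℂ).smulRight (P Δ)).restrictScalars ℝ

namespace IsPOVM

variable {ν : Measure S} {P : Set S → K →L[ℂ] K} (hP : IsPOVM ν P)

include hP

theorem empty : P ∅ = 0 := hP.null ∅ .empty measure_empty

open Classical in
/-- The complex measure `Δ ↦ ⟪k, P(Δ) l⟫`. -/
noncomputable def innerMeasure (k l : K) : ComplexMeasure S where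
  measureOf' Δ := if MeasurableSet Δ then inner ℂ k (P Δ l) else 0
  empty' := by rw [if_pos .empty, hP.empty, zero_apply, inner_zero_right]
  not_measurable' Δ hΔ := if_neg hΔ
  m_iUnion' Δ hΔ hd := by
    simpa only [hΔ, MeasurableSet.iUnion hΔ, if_true] using hP.hasSum_inner Δ hΔ hd k l

theorem innerMeasure_apply {Δ : Set S} (hΔ : MeasurableSet Δ) (k l : K) :
    hP.innerMeasure k l Δ = inner ℂ k (P Δ l) :=
  if_pos hΔ

theorem biUnion {ι : Type*} {t : Finset ι} {Δ : ι → Set S}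
    (hd : (t : Set ι).Pairwise (Disjoint on Δ)) (hΔ : ∀ i ∈ t, MeasurableSet (Δ i)) :
    P (⋃ i ∈ t, Δ i) = ∑ i ∈ t, P (Δ i) := by
  refine ContinuousLinearMap.ext fun l => ext_inner_left ℂ fun k => ?_
  rw [sum_apply, inner_sum, ← hP.innerMeasure_apply (t.measurableSet_biUnion hΔ),
    VectorMeasure.of_biUnion_finset hd hΔ]
  exact Finset.sum_congr rfl fun i hi => hP.innerMeasure_apply (hΔ i hi) k l

theorem union {Δ Δ' : Set S} (hd : Disjoint Δ Δ') (hΔ : MeasurableSet Δ)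
    (hΔ' : MeasurableSet Δ') : P (Δ ∪ Δ') = P Δ + P Δ' := by
  refine ContinuousLinearMap.ext fun l => ext_inner_left ℂ fun k => ?_
  rw [add_apply, inner_add_right, ← hP.innerMeasure_apply (hΔ.union hΔ'),
    VectorMeasure.of_union hd hΔ hΔ', hP.innerMeasure_apply hΔ, hP.innerMeasure_apply hΔ']

theorem add_compl {Δ : Set S} (hΔ : MeasurableSet Δ) : P Δ + P Δᶜ = 1 := by
  rw [← hP.union disjoint_compl_right hΔ hΔ.compl, Set.union_compl_self, hP.univ]

/-- The positive measure `Δ ↦ ⟪k, P(Δ) k⟫`. -/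
noncomputable def vectorMeasure (k : K) : Measure S :=
  Measure.ofMeasurable (fun Δ _ => ENNReal.ofReal (inner ℂ k (P Δ k)).re)
    (by rw [hP.empty, zero_apply, inner_zero_right, Complex.zero_re, ENNReal.ofReal_zero])
    fun Δ hΔ hd => by
      have hsum := Complex.hasSum_re (hP.hasSum_inner Δ hΔ hd k k)
      rw [← hsum.tsum_eq]
      exact ENNReal.ofReal_tsum_of_nonneg (fun i =>
        (Complex.nonneg_iff.mp (nonneg_iff_inner_nonneg.mp (hP.nonneg _ (hΔ i)) k)).1) hsum.summable

theorem vectorMeasure_apply {Δ : Set S} (hΔ : MeasurableSet Δ) (k : K) :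
    hP.vectorMeasure k Δ = ENNReal.ofReal (inner ℂ k (P Δ k)).re :=
  Measure.ofMeasurable_apply Δ hΔ

instance isFiniteMeasure_vectorMeasure (k : K) : IsFiniteMeasure (hP.vectorMeasure k) :=
  ⟨(hP.vectorMeasure_apply .univ k).trans_lt ENNReal.ofReal_lt_top⟩

theorem ofReal_vectorMeasure_real {Δ : Set S} (hΔ : MeasurableSet Δ) (k : K) :
    (((hP.vectorMeasure k).real Δ : ℝ) : ℂ) = inner ℂ k (P Δ k) := by
  have hinner := nonneg_iff_inner_nonneg.mp (hP.nonneg Δ hΔ) k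
  rw [measureReal_def, hP.vectorMeasure_apply hΔ,
    ENNReal.toReal_ofReal (Complex.nonneg_iff.mp hinner).1]
  exact (Complex.eq_re_of_ofReal_le (r := 0) (by exact_mod_cast hinner)).symm

theorem vectorMeasure_absolutelyContinuous (k : K) : hP.vectorMeasure k ≪ ν :=
  .mk fun Δ hΔ hnull => by
    rw [hP.vectorMeasure_apply hΔ, hP.null Δ hΔ hnull, zero_apply, inner_zero_right,
      Complex.zero_re, ENNReal.ofReal_zero]

variable [IsFiniteMeasure ν] [CompleteSpace K]

/-- The operator `∑ c P(f⁻¹{c})`, for a simple function `f`. -/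
noncomputable def simpleIntegral : SimpleFunc S ℂ →ₗ[ℂ] (K →L[ℂ] K) :=
  have hweight : FinMeasAdditive ν (smulWeight P) := fun Δ Δ' hΔ hΔ' _ _ hd => by
    ext c : 1
    exact (congrArg (c • ·) (hP.union hd hΔ hΔ')).trans (smul_add _ _ _)
  have hint (f : SimpleFunc S ℂ) : Integrable f ν := f.integrable_of_isFiniteMeasure
  { toFun := SimpleFunc.setToSimpleFunc (smulWeight P)
    map_add' := fun f g => SimpleFunc.setToSimpleFunc_add _ hweight (hint f) (hint g)
    map_smul' := fun c f =>
      SimpleFunc.setToSimpleFunc_smul _ hweight (fun c s z => smul_assoc c z (P s)) c (hint f) }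

theorem norm_simpleIntegral_le (f : SimpleFunc S ℂ) :
    ‖hP.simpleIntegral f‖ ≤ ‖simpleToLinfty ν f‖ := by
  have hfibers : ⋃ c ∈ f.range, f ⁻¹' {c} = Set.univ :=
    Set.eq_univ_of_forall fun s => Set.mem_biUnion (f.mem_range_self s) rfl
  refine norm_sum_smul_le (fun c _ => hP.nonneg _ (f.measurableSet_fiber c)) ?_ (norm_nonneg _) ?_
  · rw [← hP.biUnion (fun c _ c' _ hcc' => (Set.disjoint_singleton.mpr hcc').preimage f)
      fun c _ => f.measurableSet_fiber c, hfibers, hP.univ]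
  · intro c _ hc
    by_contra! hlt
    refine hc (hP.null _ (f.measurableSet_fiber c) (measure_mono_null ?_
      (ae_iff.mp ((ae_norm_le_norm_of_Linfty (simpleToLinfty ν f)).and (coeFn_simpleToLinfty f)))))
    rintro s rfl ⟨hle, heq⟩
    exact (heq ▸ hle).not_gt hlt

/-- The integral `∫ f dP` of an essentially bounded function `f` against `P`. -/
noncomputable def integral : Lp ℂ ∞ ν →L[ℂ] (K →L[ℂ] K) :=
  hP.simpleIntegral.extendOfNorm (simpleToLinfty ν)

theorem integral_indicatorLinfty {Δ : Set S} (hΔ : MeasurableSet Δ) (c : ℂ) :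
    hP.integral (indicatorLinfty ν hΔ c) = c • P Δ := by
  let f : SimpleFunc S ℂ := .piecewise Δ hΔ (.const S c) (.const S 0)
  have hf : indicatorLinfty ν hΔ c = simpleToLinfty ν f := by
    refine Lp.ext ?_
    filter_upwards [coeFn_indicatorLinfty (ν := ν) hΔ c, coeFn_simpleToLinfty (ν := ν) f]
      with s hs hfs
    rw [hs, hfs]
    rfl
  rw [hf, integral, LinearMap.extendOfNorm_eq denseRange_simpleToLinfty
    ⟨1, fun f => (one_mul ‖simpleToLinfty ν f‖).symm ▸ hP.norm_simpleIntegral_le f⟩]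
  exact SimpleFunc.setToSimpleFunc_indicator (T := smulWeight P)
    (ContinuousLinearMap.ext fun z => (congrArg (z • ·) hP.empty).trans (smul_zero z)) hΔ c

theorem integral_star (f : Lp ℂ ∞ ν) : hP.integral (star f) = star (hP.integral f) := by
  refine Linfty_induction (p := fun f => hP.integral (star f) = star (hP.integral f)) f
    (isClosed_eq (hP.integral.continuous.comp continuous_star_Linfty)
      (continuous_star.comp hP.integral.continuous)) (fun f g hf hg => ?_) fun Δ hΔ c => ?_
  · rw [star_add_Linfty, map_add, map_add, star_add, hf, hg]
  · rw [star_indicatorLinfty, integral_indicatorLinfty, integral_indicatorLinfty, star_smul,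
      (hP.nonneg Δ hΔ).isSelfAdjoint.star_eq]

theorem inner_integral (f : Lp ℂ ∞ ν) (k : K) :
    inner ℂ k (hP.integral f k) = ∫ s, f s ∂hP.vectorMeasure k := by
  have hac := hP.vectorMeasure_absolutelyContinuous k
  refine Linfty_induction (p := fun f => inner ℂ k (hP.integral f k) = ∫ s, f s ∂hP.vectorMeasure k)
    f (isClosed_eq (by fun_prop) (continuous_integral_Linfty hac)) (fun f g hf hg => ?_)
    fun Δ hΔ c => ?_
  · rw [map_add, add_apply, inner_add_right, hf, hg, integral_add_Linfty hac]
  · rw [integral_congr_ae (hac.ae_le (coeFn_indicatorLinfty hΔ c)), integral_indicator_const c hΔ,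
      hP.integral_indicatorLinfty, smul_apply, inner_smul_right, ← hP.ofReal_vectorMeasure_real hΔ,
      Complex.real_smul, mul_comm]

end IsPOVM

end PositiveOperatorValuedMeasure

section SpectralMeasure

/-! ### Spectral measures -/

variable {K : Type*} [NormedAddCommGroup K] [InnerProductSpace ℂ K] {S : Type*} [MeasurableSpace S]

/-- A spectral measure is a projection valued `IsPOVM`. -/
structure IsSpectralMeasure (ν : Measure S) (P : Set S → K →L[ℂ] K) : Prop extends IsPOVM ν P where
  mul_self : ∀ Δ, MeasurableSet Δ → P Δ * P Δ = P Δ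

variable [CompleteSpace K]

namespace IsPOVM

variable {ν : Measure S} [IsFiniteMeasure ν] {P : Set S → K →L[ℂ] K}

theorem isSpectralMeasure_of_integral_smul (hP : IsPOVM ν P)
    (hmul : ∀ f g : Lp ℂ ∞ ν, hP.integral (f • g : Lp ℂ ∞ ν) = hP.integral f * hP.integral g) :
    IsSpectralMeasure ν P where
  toIsPOVM := hP
  mul_self Δ hΔ := by
    have h := hmul (indicatorLinfty ν hΔ 1) (indicatorLinfty ν hΔ 1)
    simp only [indicatorLinfty_smul, hP.integral_indicatorLinfty, Set.inter_self, mul_one,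
      one_smul] at h
    exact h.symm

end IsPOVM

namespace IsSpectralMeasure

variable {ν : Measure S} {P : Set S → K →L[ℂ] K} (hP : IsSpectralMeasure ν P)

include hP

theorem mul_eq_zero_of_disjoint {Δ Δ' : Set S} (hΔ : MeasurableSet Δ) (hΔ' : MeasurableSet Δ')
    (hd : Disjoint Δ Δ') : P Δ * P Δ' = 0 := by
  have hle : P Δ ≤ 1 - P Δ' := by
    rw [le_sub_iff_add_le, ← hP.union hd hΔ hΔ', ← hP.add_compl (hΔ.union hΔ')]
    exact le_add_of_nonneg_right (hP.nonneg _ (hΔ.union hΔ').compl)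
  refine mul_eq_zero_of_le_of_mul_eq_zero (hP.nonneg Δ hΔ) hle ?_
  rw [sub_mul, one_mul, hP.mul_self Δ' hΔ', sub_self]

theorem inter_eq_mul {Δ Δ' : Set S} (hΔ : MeasurableSet Δ) (hΔ' : MeasurableSet Δ') :
    P (Δ ∩ Δ') = P Δ * P Δ' := by
  have hsplit {A B : Set S} (hA : MeasurableSet A) (hB : MeasurableSet B) :
      P A = P (A ∩ B) + P (A \ B) := by
    rw [← hP.union Set.disjoint_sdiff_inter.symm (hA.inter hB) (hA.diff hB), Set.inter_union_sdiff]
  have hinter := hΔ.inter hΔ'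
  rw [hsplit hΔ hΔ', hsplit hΔ' hΔ, Set.inter_comm Δ' Δ, add_mul, mul_add, mul_add,
    hP.mul_self _ hinter,
    hP.mul_eq_zero_of_disjoint hinter (hΔ'.diff hΔ)
      (disjoint_sdiff_self_right.mono_left Set.inter_subset_left),
    hP.mul_eq_zero_of_disjoint (hΔ.diff hΔ') hinter
      (disjoint_sdiff_self_left.mono_right Set.inter_subset_right),
    hP.mul_eq_zero_of_disjoint (hΔ.diff hΔ') (hΔ'.diff hΔ)
      (disjoint_sdiff_self_left.mono_right Set.sdiff_subset), add_zero, add_zero, add_zero]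

theorem commute {Δ Δ' : Set S} (hΔ : MeasurableSet Δ) (hΔ' : MeasurableSet Δ') :
    Commute (P Δ) (P Δ') := by
  rw [Commute, SemiconjBy, ← hP.inter_eq_mul hΔ hΔ', Set.inter_comm, hP.inter_eq_mul hΔ' hΔ]

theorem vectorMeasure_real {Δ : Set S} (hΔ : MeasurableSet Δ) (k : K) :
    (hP.vectorMeasure k).real Δ = ‖P Δ k‖ ^ 2 := by
  have hstar : P Δ = star (P Δ) * P Δ := by
    rw [(hP.nonneg Δ hΔ).isSelfAdjoint.star_eq, hP.mul_self Δ hΔ]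
  have hinner := hP.ofReal_vectorMeasure_real hΔ k
  rw [hstar, mul_apply_eq_comp, ContinuousLinearMap.star_eq_adjoint,
    ContinuousLinearMap.adjoint_inner_right, inner_self_eq_norm_sq_to_K] at hinner
  exact Complex.ofReal_injective (hinner.trans (Complex.ofReal_pow _ _).symm)

theorem vectorMeasure_eq_zero_iff {Δ : Set S} (hΔ : MeasurableSet Δ) {k : K} :
    hP.vectorMeasure k Δ = 0 ↔ P Δ k = 0 := by
  rw [← measureReal_eq_zero_iff, hP.vectorMeasure_real hΔ, sq_eq_zero_iff, norm_eq_zero]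

section Integral

variable [IsFiniteMeasure ν]

theorem integral_smul (f g : Lp ℂ ∞ ν) :
    hP.integral (f • g : Lp ℂ ∞ ν) = hP.integral f * hP.integral g := by
  refine Linfty_induction
    (p := fun g => hP.integral (f • g : Lp ℂ ∞ ν) = hP.integral f * hP.integral g) g
    (isClosed_eq (hP.integral.continuous.comp (continuous_smul_right_Linfty f))
      (continuous_const.mul hP.integral.continuous))
    (fun g g' hg hg' => by rw [Lp.add_smul, map_add, map_add, mul_add, hg, hg']) fun Δ hΔ c => ?_
  rw [smul_comm_Linfty]
  refine Linfty_induction (p := fun f => hP.integral (indicatorLinfty ν hΔ c • f : Lp ℂ ∞ ν) =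
      hP.integral f * hP.integral (indicatorLinfty ν hΔ c)) f
    (isClosed_eq (hP.integral.continuous.comp (continuous_smul_right_Linfty _))
      (hP.integral.continuous.mul continuous_const))
    (fun f f' hf hf' => by rw [Lp.add_smul, map_add, map_add, add_mul, hf, hf']) fun Δ' hΔ' c' => ?_
  simp only [indicatorLinfty_smul, hP.integral_indicatorLinfty, smul_mul_smul_comm,
    hP.inter_eq_mul hΔ hΔ', (hP.commute hΔ hΔ').eq, mul_comm c c']

theorem integral_mul_comm (f g : Lp ℂ ∞ ν) : Commute (hP.integral f) (hP.integral g) := by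
  rw [Commute, SemiconjBy, ← hP.integral_smul, smul_comm_Linfty, hP.integral_smul]

theorem norm_integral_apply_sq (f : Lp ℂ ∞ ν) (k : K) :
    ‖hP.integral f k‖ ^ 2 = ∫ s, ‖f s‖ ^ 2 ∂hP.vectorMeasure k := by
  have hac := hP.vectorMeasure_absolutelyContinuous k
  rw [← Complex.ofReal_inj, ← integral_complex_ofReal]
  push_cast
  refine (inner_self_eq_norm_sq_to_K (𝕜 := ℂ) (hP.integral f k)).symm.trans ?_
  rw [← ContinuousLinearMap.adjoint_inner_right, ← ContinuousLinearMap.star_eq_adjoint,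
    ← hP.integral_star, ← mul_apply_eq_comp, ← hP.integral_smul, hP.inner_integral]
  refine integral_congr_ae ?_
  filter_upwards [hac.ae_le (Lp.coeFn_lpSMul (r := ∞) (star f) f), hac.ae_le (Lp.coeFn_star f)]
    with s hsmul hstar
  rw [hsmul, Pi.smul_apply', hstar, Pi.star_apply, smul_eq_mul]
  exact Complex.conj_mul' (f s)

theorem integral_apply_eq_zero_iff {f : Lp ℂ ∞ ν} {k : K} :
    hP.integral f k = 0 ↔ P {s | f s ≠ 0} k = 0 := by
  have hac := hP.vectorMeasure_absolutelyContinuous k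
  have hsq : Integrable (fun s => ‖f s‖ ^ 2) (hP.vectorMeasure k) := by
    refine .of_bound ((integrable_Linfty hac f).aestronglyMeasurable.norm.pow 2) (‖f‖ ^ 2)
      (hac.ae_le ?_)
    filter_upwards [ae_norm_le_norm_of_Linfty f] with s hs
    rw [norm_pow, norm_norm]
    gcongr
  rw [← hP.vectorMeasure_eq_zero_iff (measurableSet_support_Linfty f), ← norm_eq_zero,
    ← sq_eq_zero_iff, hP.norm_integral_apply_sq,
    integral_eq_zero_iff_of_nonneg (fun s => by positivity) hsq]
  simp only [Filter.EventuallyEq, ae_iff, Pi.zero_apply, sq_eq_zero_iff, norm_eq_zero, ne_eq]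

theorem integral_injective (hnull : ∀ Δ, MeasurableSet Δ → P Δ = 0 → ν Δ = 0) :
    Injective hP.integral := by
  refine (injective_iff_map_eq_zero _).mpr fun f hf => ?_
  refine Lp.eq_zero_iff_ae_eq_zero.mpr (ae_iff.mpr (hnull _ (measurableSet_support_Linfty f) ?_))
  exact ContinuousLinearMap.ext fun k =>
    hP.integral_apply_eq_zero_iff.mp (by rw [hf, zero_apply])

end Integral

end IsSpectralMeasure

end SpectralMeasure

section ComplexMeasure

/-! ### Integration against a complex measure -/

variable {S : Type*} [MeasurableSpace S] {ν : Measure S} {m : ComplexMeasure S}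

theorem isFiniteMeasure_variation_complexMeasure (m : ComplexMeasure S) :
    IsFiniteMeasure m.variation := by
  refine isFiniteMeasure_of_le
    ((ComplexMeasure.re m).totalVariation + (ComplexMeasure.im m).totalVariation)
    (VectorMeasure.variation_le_of_forall_enorm_le fun Δ _ => ?_)
  have hsplit : m Δ = (ComplexMeasure.re m Δ : ℂ) + (ComplexMeasure.im m Δ : ℂ) * Complex.I :=
    (Complex.re_add_im (m Δ)).symm
  have hre : ‖(ComplexMeasure.re m Δ : ℂ)‖ₑ = ‖ComplexMeasure.re m Δ‖ₑ :=
    enorm_eq_iff_norm_eq.mpr (Complex.norm_real _)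
  have him : ‖(ComplexMeasure.im m Δ : ℂ) * Complex.I‖ₑ = ‖ComplexMeasure.im m Δ‖ₑ :=
    enorm_eq_iff_norm_eq.mpr (by rw [norm_mul, Complex.norm_I, mul_one, Complex.norm_real])
  calc ‖m Δ‖ₑ ≤ ‖ComplexMeasure.re m Δ‖ₑ + ‖ComplexMeasure.im m Δ‖ₑ := by
        rw [← hre, ← him, hsplit]
        exact enorm_add_le _ _
    _ ≤ _ := add_le_add (SignedMeasure.enorm_le_totalVariation _ Δ)
        (SignedMeasure.enorm_le_totalVariation _ Δ)

theorem variation_absolutelyContinuous (hm : ∀ Δ, MeasurableSet Δ → ν Δ = 0 → m Δ = 0) :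
    m.variation ≪ ν :=
  .mk fun _ hΔ hnull => (VectorMeasure.variation_apply_eq_zero hΔ).mpr fun Δ' hsub hΔ' =>
    hm Δ' hΔ' (measure_mono_null hsub hnull)

theorem vectorIntegral_add_Linfty (hm : m.variation ≪ ν) (f g : Lp ℂ ∞ ν) :
    ∫ᵛ s, (f + g : Lp ℂ ∞ ν) s ∂[ContinuousLinearMap.mul ℝ ℂ; m] =
      ∫ᵛ s, f s ∂[ContinuousLinearMap.mul ℝ ℂ; m] +
        ∫ᵛ s, g s ∂[ContinuousLinearMap.mul ℝ ℂ; m] := by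
  have := isFiniteMeasure_variation_complexMeasure m
  rw [← VectorMeasure.integral_fun_add (integrable_Linfty hm f) (integrable_Linfty hm g)]
  exact VectorMeasure.integral_congr_ae (hm.ae_le (Lp.coeFn_add f g))

theorem continuous_vectorIntegral_Linfty (hm : m.variation ≪ ν) :
    Continuous fun f : Lp ℂ ∞ ν => ∫ᵛ s, f s ∂[ContinuousLinearMap.mul ℝ ℂ; m] :=
  have := isFiniteMeasure_variation_complexMeasure m
  AddMonoidHomClass.continuous_of_bound
    (AddMonoidHom.mk' (fun f : Lp ℂ ∞ ν => ∫ᵛ s, f s ∂[ContinuousLinearMap.mul ℝ ℂ; m])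
      (vectorIntegral_add_Linfty hm))
    (‖ContinuousLinearMap.mul ℝ ℂ‖ * m.variation.real Set.univ) fun f => by
      refine (VectorMeasure.norm_integral_le_of_norm_le_const
        (hm.ae_le (ae_norm_le_norm_of_Linfty f))).trans_eq ?_
      ring

theorem eq_vectorIntegral_of_indicatorLinfty [IsFiniteMeasure ν]
    (hm : ∀ Δ, MeasurableSet Δ → ν Δ = 0 → m Δ = 0) {φ : Lp ℂ ∞ ν →L[ℂ] ℂ}
    (hφ : ∀ (Δ : Set S) (hΔ : MeasurableSet Δ) (c : ℂ), φ (indicatorLinfty ν hΔ c) = c * m Δ)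
    (f : Lp ℂ ∞ ν) : φ f = ∫ᵛ s, f s ∂[ContinuousLinearMap.mul ℝ ℂ; m] := by
  have hac := variation_absolutelyContinuous hm
  refine Linfty_induction (p := fun f => φ f = ∫ᵛ s, f s ∂[ContinuousLinearMap.mul ℝ ℂ; m]) f
    (isClosed_eq φ.continuous (continuous_vectorIntegral_Linfty hac))
    (fun f g hf hg => by rw [map_add, vectorIntegral_add_Linfty hac, hf, hg]) fun Δ hΔ c => ?_
  have hfin := isFiniteMeasure_variation_complexMeasure m
  rw [hφ, VectorMeasure.integral_congr_ae (hac.ae_le (coeFn_indicatorLinfty hΔ c)),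
    VectorMeasure.integral_indicator hΔ, VectorMeasure.setIntegral_const]
  rfl

end ComplexMeasure

section DenseSpan

/-! ### Convergence on a dense subspace -/

theorem tendsto_of_dense_span {ι E F : Type*} [NormedAddCommGroup E]
    [NormedSpace ℂ E] [NormedAddCommGroup F] [NormedSpace ℂ F] {u : Filter ι}
    {φ : ι → E →L[ℂ] F} {C : NNReal} (hC : ∀ i, ‖φ i‖₊ ≤ C) {ψ : E →L[ℂ] F} {G : Set E}
    (hG : Dense (Submodule.span ℂ G : Set E))
    (h : ∀ x ∈ G, Filter.Tendsto (fun i => φ i x) u (nhds (ψ x))) (x : E) :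
    Filter.Tendsto (fun i => φ i x) u (nhds (ψ x)) := by
  have hclosed : IsClosed {x | Filter.Tendsto (fun i => φ i x) u (nhds (ψ x))} :=
    (LipschitzWith.uniformEquicontinuous (fun i => φ i) C fun i =>
      (φ i).lipschitz.weaken (hC i)).equicontinuous.isClosed_setOfPred_tendsto ψ.continuous
  refine closure_minimal (fun y hy => ?_) hclosed (hG x)
  induction hy using Submodule.span_induction with
  | mem y hy => exact h y hy
  | zero => simpa only [Set.mem_ofPred_eq, map_zero] using tendsto_const_nhds
  | add y z _ _ hy hz => simpa only [Set.mem_ofPred_eq, map_add] using hy.add hz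
  | smul c y _ hy => simpa only [Set.mem_ofPred_eq, map_smul] using hy.const_smul c

variable {K : Type*} [NormedAddCommGroup K] [InnerProductSpace ℂ K]

theorem hasSum_inner_right_of_dense_span {A : ℕ → K →L[ℂ] K} {B : K →L[ℂ] K} {C : NNReal}
    (hC : ∀ t : Finset ℕ, ‖∑ i ∈ t, A i‖₊ ≤ C) {G : Set K}
    (hG : Dense (Submodule.span ℂ G : Set K)) {k : K}
    (h : ∀ l ∈ G, HasSum (fun i => inner ℂ k (A i l)) (inner ℂ k (B l))) (l : K) :
    HasSum (fun i => inner ℂ k (A i l)) (inner ℂ k (B l)) := by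
  have htendsto := tendsto_of_dense_span (u := Filter.atTop)
    (φ := fun t => innerSL ℂ k ∘L ∑ i ∈ t, A i) (ψ := innerSL ℂ k ∘L B) (C := ‖k‖₊ * C)
    (fun t => (ContinuousLinearMap.opNNNorm_comp_le _ _).trans
      (mul_le_mul' (innerSL_apply_norm ℂ k).le (hC t))) hG
  simp only [ContinuousLinearMap.comp_apply, sum_apply, innerSL_apply_apply, inner_sum]
    at htendsto
  exact htendsto h l

theorem hasSum_inner_of_dense_span [CompleteSpace K] {A : ℕ → K →L[ℂ] K} {B : K →L[ℂ] K}
    {C : NNReal} (hC : ∀ t : Finset ℕ, ‖∑ i ∈ t, A i‖₊ ≤ C) {G : Set K}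
    (hG : Dense (Submodule.span ℂ G : Set K))
    (h : ∀ k ∈ G, ∀ l ∈ G, HasSum (fun i => inner ℂ k (A i l)) (inner ℂ k (B l))) (k l : K) :
    HasSum (fun i => inner ℂ k (A i l)) (inner ℂ k (B l)) := by
  have hstar (A : K →L[ℂ] K) (k l : K) : star (inner ℂ k (A l)) = inner ℂ l (star A k) := by
    rw [ContinuousLinearMap.star_eq_adjoint, ContinuousLinearMap.adjoint_inner_right]
    exact inner_conj_symm _ _
  have hadjoint := hasSum_inner_right_of_dense_span (A := fun i => star (A i))
    (B := star B) (fun t => by rw [← star_sum, nnnorm_star]; exact hC t) hG (k := l) fun k hk => by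
      simpa only [hstar] using
        (hasSum_inner_right_of_dense_span hC hG (h k hk) l).star
  simpa only [hstar, star_star] using (hadjoint k).star

theorem isPOVM_of_dense_span [CompleteSpace K] {S : Type*} [MeasurableSpace S] {ν : Measure S}
    [IsFiniteMeasure ν] {P : Set S → K →L[ℂ] K} (hnonneg : ∀ Δ, MeasurableSet Δ → 0 ≤ P Δ)
    (huniv : P Set.univ = 1) (hnull : ∀ Δ, MeasurableSet Δ → ν Δ = 0 → P Δ = 0)
    (hunion : ∀ Δ Δ', MeasurableSet Δ → MeasurableSet Δ' → Disjoint Δ Δ' →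
      P (Δ ∪ Δ') = P Δ + P Δ')
    {G : Set K} (hG : Dense (Submodule.span ℂ G : Set K))
    (hsum : ∀ Δ : ℕ → Set S, (∀ i, MeasurableSet (Δ i)) → Pairwise (Disjoint on Δ) →
      ∀ k ∈ G, ∀ l ∈ G, HasSum (fun i => inner ℂ k (P (Δ i) l)) (inner ℂ k (P (⋃ i, Δ i) l))) :
    IsPOVM ν P where
  nonneg := hnonneg
  univ := huniv
  null := hnull
  hasSum_inner Δ hΔ hd := by
    have hadd : FinMeasAdditive ν P := fun Δ Δ' hΔ hΔ' _ _ => hunion Δ Δ' hΔ hΔ'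
    refine hasSum_inner_of_dense_span (C := 1) (fun t => ?_) hG (hsum Δ hΔ hd)
    have hU : MeasurableSet (⋃ i ∈ t, Δ i) := t.measurableSet_biUnion fun i _ => hΔ i
    rw [← hadd.map_iUnion_fin_meas_set_eq_sum P (hnull ∅ .empty measure_empty) Δ t hΔ
      (fun i _ => measure_ne_top ν _) fun i _ j _ hij => hd hij]
    refine (CStarAlgebra.norm_le_one_iff_of_nonneg _ (hnonneg _ hU)).mpr ?_
    rw [← huniv, ← Set.union_compl_self (⋃ i ∈ t, Δ i), hunion _ _ hU hU.compl disjoint_compl_right]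
    exact le_add_of_nonneg_right (hnonneg _ hU.compl)

end DenseSpan

section Bicommutant

/-! ### The bicommutant of a star algebra -/

variable {K : Type*} [NormedAddCommGroup K] [InnerProductSpace ℂ K]

theorem commute_starProjection_iff {L : Submodule ℂ K} [L.HasOrthogonalProjection]
    {A : K →L[ℂ] K} :
    Commute L.starProjection A ↔ (∀ k ∈ L, A k ∈ L) ∧ ∀ k ∈ Lᗮ, A k ∈ Lᗮ := by
  rw [ContinuousLinearMap.IsIdempotentElem.commute_iff L.isIdempotentElem_starProjection,
    L.range_starProjection, L.ker_starProjection]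
  rfl

variable [CompleteSpace K] {N : StarSubalgebra ℂ (K →L[ℂ] K)}

/-- The bicommutant `N''`, as a star subalgebra. -/
noncomputable def bicommutant (N : StarSubalgebra ℂ (K →L[ℂ] K)) : StarSubalgebra ℂ (K →L[ℂ] K) :=
  .centralizer ℂ (StarSubalgebra.centralizer ℂ (N : Set (K →L[ℂ] K)))

theorem coe_bicommutant (N : StarSubalgebra ℂ (K →L[ℂ] K)) :
    (bicommutant N : Set (K →L[ℂ] K)) = (N : Set (K →L[ℂ] K)).centralizer.centralizer := by
  rw [bicommutant, StarSubalgebra.coe_centralizer_centralizer, StarMemClass.star_coe_eq,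
    Set.union_self]

theorem mem_bicommutant_iff {A : K →L[ℂ] K} :
    A ∈ bicommutant N ↔ A ∈ (N : Set (K →L[ℂ] K)).centralizer.centralizer := by
  rw [← coe_bicommutant, SetLike.mem_coe]

theorem le_bicommutant (N : StarSubalgebra ℂ (K →L[ℂ] K)) : N ≤ bicommutant N := fun _ hA =>
  mem_bicommutant_iff.mpr (Set.subset_centralizer_centralizer hA)

theorem bicommutant_le_centralizer {s : Set (K →L[ℂ] K)}
    (h : N ≤ StarSubalgebra.centralizer ℂ s) : bicommutant N ≤ StarSubalgebra.centralizer ℂ s := by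
  rw [← SetLike.coe_subset_coe, StarSubalgebra.coe_centralizer] at h ⊢
  rw [coe_bicommutant, ← Set.centralizer_centralizer_centralizer (s ∪ star s)]
  exact Set.centralizer_subset (Set.centralizer_subset h)

theorem apply_mem_closure_of_mem_bicommutant {B : K →L[ℂ] K}
    (hB : B ∈ bicommutant N) (w : K) :
    B w ∈ closure {k | ∃ A ∈ N, A w = k} := by
  let N₀ : Submodule ℂ K :=
    N.toSubalgebra.toSubmodule.map (ContinuousLinearMap.apply ℂ K w).toLinearMap
  let L : Submodule ℂ K := N₀.topologicalClosure
  have : CompleteSpace L := N₀.isClosed_topologicalClosure.completeSpace_coe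
  have hL : ∀ A ∈ N, ∀ k ∈ L, A k ∈ L := fun A hA k hk => map_mem_closure A.continuous hk <| by
    rintro _ ⟨A', hA', rfl⟩
    exact ⟨A * A', N.mul_mem hA hA', rfl⟩
  have hcommute : L.starProjection ∈ (N : Set (K →L[ℂ] K)).centralizer := fun A hA =>
    (commute_starProjection_iff.mpr ⟨hL A hA, fun k hk l hl => by
      rw [← ContinuousLinearMap.adjoint_inner_left]
      exact hk _ (hL _ (star_mem hA) l hl)⟩).symm
  have hw : w ∈ L := subset_closure ⟨1, N.one_mem, rfl⟩
  have hBw : L.starProjection (B w) = B (L.starProjection w) :=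
    DFunLike.congr_fun (mem_bicommutant_iff.mp hB _ hcommute) w
  rw [Submodule.starProjection_eq_self_iff.mpr hw] at hBw
  exact Submodule.starProjection_eq_self_iff.mp hBw

end Bicommutant

section Amplification

/-! ### Amplification to countably many copies -/

variable {K : Type*} [NormedAddCommGroup K] [InnerProductSpace ℂ K]

theorem dense_span_single :
    Dense (Submodule.span ℂ {k : lp (fun _ : ℕ => K) 2 | ∃ n l, k = lp.single 2 n l} :
      Set (lp (fun _ : ℕ => K) 2)) := fun k =>
  mem_closure_of_tendsto (lp.hasSum_single (by simp) k) (.of_forall fun _ =>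
    sum_mem fun n _ => Submodule.subset_span ⟨n, k n, rfl⟩)

/-- The matrix entry `E_{mn} ∈ B(K)` of an operator `E` on `ℓ²(ℕ; K)`. -/
noncomputable def matrixEntry (E : lp (fun _ : ℕ => K) 2 →L[ℂ] lp (fun _ : ℕ => K) 2) (m n : ℕ) :
    K →L[ℂ] K :=
  lp.evalCLM ℂ (fun _ => K) 2 m ∘L E ∘L lp.singleContinuousLinearMap ℂ (fun _ => K) 2 n

variable [CompleteSpace K]

variable (K) in
/-- The amplification `A ↦ A ⊗ 1` of `B(K)` to the Hilbert space `ℓ²(ℕ; K)`. -/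
noncomputable def amplification :
    (K →L[ℂ] K) →⋆ₐ[ℂ] (lp (fun _ : ℕ => K) 2 →L[ℂ] lp (fun _ : ℕ => K) 2) where
  toFun A := lp.mapCLM 2 (fun _ => A) (norm_nonneg A) fun _ => le_rfl
  map_one' := rfl
  map_mul' _ _ := rfl
  map_zero' := rfl
  map_add' _ _ := rfl
  commutes' _ := rfl
  map_star' A := by
    refine (ContinuousLinearMap.eq_adjoint_iff _ _).mpr fun k l => ?_
    rw [lp.inner_eq_tsum, lp.inner_eq_tsum]
    exact tsum_congr fun n => ContinuousLinearMap.adjoint_inner_left A _ _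

theorem amplification_apply (A : K →L[ℂ] K) (k : lp (fun _ : ℕ => K) 2) (n : ℕ) :
    amplification K A k n = A (k n) :=
  rfl

theorem amplification_single (A : K →L[ℂ] K) (n : ℕ) (k : K) :
    amplification K A (lp.single 2 n k) = lp.single 2 n (A k) := by
  ext m
  rw [amplification_apply, lp.single_apply, lp.single_apply]
  exact Pi.apply_single (fun _ => A) (fun _ => map_zero A) n k m

theorem commute_amplification_iff {A : K →L[ℂ] K}
    {E : lp (fun _ : ℕ => K) 2 →L[ℂ] lp (fun _ : ℕ => K) 2} :
    Commute E (amplification K A) ↔ ∀ m n, Commute (matrixEntry E m n) A := by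
  constructor
  · intro h m n
    ext k
    have hk := congrArg (· m) (DFunLike.congr_fun h.eq (lp.single 2 n k))
    rw [mul_apply_eq_comp, amplification_single] at hk
    exact hk
  · intro h
    refine lp.ext_continuousLinearMap (by simp) fun n => ?_
    ext k m
    have hk := DFunLike.congr_fun (h m n).eq k
    simp only [ContinuousLinearMap.comp_apply, lp.singleContinuousLinearMap_apply,
      mul_apply_eq_comp, amplification_single]
    exact hk

theorem amplification_mem_bicommutant {N : StarSubalgebra ℂ (K →L[ℂ] K)} {A : K →L[ℂ] K}
    (hA : A ∈ bicommutant N) : amplification K A ∈ bicommutant (N.map (amplification K)) :=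
  mem_bicommutant_iff.mpr fun E hE => (commute_amplification_iff.mpr fun m n =>
    mem_bicommutant_iff.mp hA (matrixEntry E m n) fun B hB =>
      (commute_amplification_iff.mp (hE _ ⟨B, hB, rfl⟩).symm m n).symm).eq

variable {S : Type*} [MeasurableSpace S] {ν : Measure S} [IsFiniteMeasure ν]
  {P : Set S → K →L[ℂ] K}

protected theorem IsPOVM.amplification (hP : IsPOVM ν P) :
    IsPOVM ν fun Δ => amplification K (P Δ) := by
  refine isPOVM_of_dense_span (fun Δ hΔ => map_nonneg _ (hP.nonneg Δ hΔ))
    (by rw [hP.univ, map_one]) (fun Δ hΔ hnull => by rw [hP.null Δ hΔ hnull, map_zero])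
    (fun Δ Δ' hΔ hΔ' hd => by rw [hP.union hd hΔ hΔ', map_add]) dense_span_single ?_
  rintro Δ hΔ hd _ ⟨m, k, rfl⟩ _ ⟨n, l, rfl⟩
  simp only [amplification_single, lp.inner_single_left, lp.single_apply]
  by_cases hmn : m = n
  · subst hmn
    simpa only [Pi.single_eq_same] using hP.hasSum_inner Δ hΔ hd k l
  · simpa only [Pi.single_eq_of_ne hmn, inner_zero_right] using hasSum_zero

protected theorem IsSpectralMeasure.amplification (hP : IsSpectralMeasure ν P) :
    IsSpectralMeasure ν fun Δ => amplification K (P Δ) where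
  toIsPOVM := hP.toIsPOVM.amplification
  mul_self Δ hΔ := by rw [← map_mul, hP.mul_self Δ hΔ]

theorem IsPOVM.integral_amplification (hP : IsPOVM ν P) (f : Lp ℂ ∞ ν) :
    hP.amplification.integral f = amplification K (hP.integral f) := by
  refine Linfty_induction
    (p := fun f => hP.amplification.integral f = amplification K (hP.integral f)) f
    (isClosed_eq hP.amplification.integral.continuous
      ((map_continuous (amplification K)).comp hP.integral.continuous))
    (fun f g hf hg => by simp only [map_add, hf, hg]) fun Δ hΔ c => ?_
  rw [integral_indicatorLinfty, integral_indicatorLinfty, map_smul]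

end Amplification

section SpectralBicommutant

/-! ### The bicommutant of a spectral measure -/

variable {K : Type*} [NormedAddCommGroup K] [InnerProductSpace ℂ K] [CompleteSpace K]

variable {S : Type*} [MeasurableSpace S] {ν : Measure S}

theorem exists_Linfty_setIntegral_eq_of_le {m m' : Measure S} [IsFiniteMeasure m']
    (hm : m ≤ m') (hac : m' ≪ ν) :
    ∃ g : Lp ℂ ∞ ν, ∀ Δ, MeasurableSet Δ → ∫ s in Δ, g s ∂m' = m.real Δ := by
  have : IsFiniteMeasure m := isFiniteMeasure_of_le m' hm
  have hle : m.rnDeriv m' ≤ᵐ[m'] fun _ => 1 :=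
    ae_le_of_forall_setLIntegral_le_of_sigmaFinite (Measure.measurable_rnDeriv _ _) fun Δ _ _ => by
      rw [Measure.setLIntegral_rnDeriv (Measure.absolutelyContinuous_of_le hm), setLIntegral_one]
      exact hm Δ
  let g : S → ℂ := fun s => ((min (m.rnDeriv m' s).toReal 1 : ℝ) : ℂ)
  have hg : MemLp g ∞ ν := memLp_top_of_bound
    (Complex.measurable_ofReal.comp ((Measure.measurable_rnDeriv m m').ennreal_toReal.min
      measurable_const)).aestronglyMeasurable 1 (.of_forall fun s => by
        rw [Complex.norm_real, Real.norm_of_nonneg (by positivity)]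
        exact min_le_right _ _)
  have hgeq : hg.toLp =ᵐ[m'] fun s => (((m.rnDeriv m' s).toReal : ℝ) : ℂ) := by
    filter_upwards [hac.ae_le hg.coeFn_toLp, hle] with s hs hs1
    rw [hs]
    exact congrArg Complex.ofReal (min_eq_left (ENNReal.toReal_le_of_le_ofReal zero_le_one
      (hs1.trans_eq ENNReal.ofReal_one.symm)))
  refine ⟨hg.toLp, fun Δ _ => ?_⟩
  rw [integral_congr_ae (ae_restrict_of_ae hgeq), integral_complex_ofReal,
    Measure.setIntegral_toReal_rnDeriv (Measure.absolutelyContinuous_of_le hm)]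

namespace IsSpectralMeasure

variable {P : Set S → K →L[ℂ] K} (hP : IsSpectralMeasure ν P)

include hP

theorem vectorMeasure_apply_self {Δ : Set S} (hΔ : MeasurableSet Δ) (k : K) :
    hP.vectorMeasure (P Δ k) = (hP.vectorMeasure k).restrict Δ := by
  refine Measure.ext fun Δ' hΔ' => ?_
  rw [Measure.restrict_apply hΔ', ← ofReal_measureReal, ← ofReal_measureReal,
    hP.vectorMeasure_real hΔ', hP.vectorMeasure_real (hΔ'.inter hΔ), hP.inter_eq_mul hΔ' hΔ,
    mul_apply_eq_comp]

theorem inner_apply_of_commute {Δ : Set S} (hΔ : MeasurableSet Δ) {B : K →L[ℂ] K}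
    (hB : Commute B (P Δ)) (k : K) : inner ℂ (P Δ k) (B k) = inner ℂ (P Δ k) (B (P Δ k)) := by
  have hBk : B (P Δ k) = P Δ (B k) := DFunLike.congr_fun hB.eq k
  have hsymm := (hP.nonneg Δ hΔ).isSelfAdjoint.isSymmetric (P Δ k) (B k)
  rw [ContinuousLinearMap.coe_coe, ← mul_apply_eq_comp, hP.mul_self Δ hΔ] at hsymm
  rw [hBk]
  exact hsymm

theorem vectorMeasure_apply_le {b : K →L[ℂ] K} (hb1 : ‖b‖ ≤ 1)
    (hb : ∀ Δ, MeasurableSet Δ → Commute b (P Δ)) (w : K) :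
    hP.vectorMeasure (b w) ≤ hP.vectorMeasure w := by
  refine Measure.le_iff.mpr fun Δ hΔ => ?_
  have hbw : P Δ (b w) = b (P Δ w) := DFunLike.congr_fun (hb Δ hΔ).eq.symm w
  rw [← ofReal_measureReal, ← ofReal_measureReal, hP.vectorMeasure_real hΔ,
    hP.vectorMeasure_real hΔ, hbw]
  gcongr
  exact b.le_of_opNorm_le hb1 _ |>.trans_eq (one_mul _)

variable [IsFiniteMeasure ν]

/-- The star algebra of all integrals `∫ f dP`. -/
noncomputable def integralAlgebra : StarSubalgebra ℂ (K →L[ℂ] K) where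
  carrier := Set.range hP.integral
  mul_mem' := by
    rintro _ _ ⟨f, rfl⟩ ⟨g, rfl⟩
    exact ⟨f • g, hP.integral_smul f g⟩
  add_mem' := by
    rintro _ _ ⟨f, rfl⟩ ⟨g, rfl⟩
    exact ⟨f + g, map_add _ f g⟩
  algebraMap_mem' c := ⟨indicatorLinfty ν .univ c, by
    rw [hP.integral_indicatorLinfty, hP.univ, Algebra.algebraMap_eq_smul_one]⟩
  star_mem' := by
    rintro _ ⟨f, rfl⟩
    exact ⟨star f, hP.integral_star f⟩

theorem coe_integralAlgebra :
    (hP.integralAlgebra : Set (K →L[ℂ] K)) = Set.range hP.integral :=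
  rfl

theorem mem_integralAlgebra_of_measurableSet {Δ : Set S} (hΔ : MeasurableSet Δ) :
    P Δ ∈ hP.integralAlgebra :=
  ⟨indicatorLinfty ν hΔ 1, by rw [hP.integral_indicatorLinfty, one_smul]⟩

theorem commute_of_mem_bicommutant {B : K →L[ℂ] K}
    (hB : B ∈ bicommutant hP.integralAlgebra) {Δ : Set S}
    (hΔ : MeasurableSet Δ) : Commute B (P Δ) := by
  obtain ⟨f, hf⟩ := hP.mem_integralAlgebra_of_measurableSet hΔ
  refine (mem_bicommutant_iff.mp hB (P Δ) ?_).symm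
  rintro _ ⟨g, rfl⟩
  rw [← hf]
  exact hP.integral_mul_comm g f

theorem exists_inner_integral_eq {B : K →L[ℂ] K} (hB0 : 0 ≤ B) (hB1 : B ≤ 1)
    (hB : ∀ Δ, MeasurableSet Δ → Commute B (P Δ)) (w : K) :
    ∃ g, ∀ Δ, MeasurableSet Δ → inner ℂ (P Δ w) (hP.integral g w) = inner ℂ (P Δ w) (B w) := by
  let b := CFC.sqrt B
  have hbb : b * b = B := CFC.sqrt_mul_sqrt_self B hB0
  have hbstar : IsSelfAdjoint b := (CFC.sqrt_nonneg B).isSelfAdjoint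
  have hb1 : ‖b‖ ≤ 1 :=
    (CFC.norm_sqrt B hB0).trans_le
      (Real.sqrt_le_one.mpr ((CStarAlgebra.norm_le_one_iff_of_nonneg B hB0).mpr hB1))
  have hb : ∀ Δ, MeasurableSet Δ → Commute b (P Δ) := fun Δ hΔ => (hB Δ hΔ).cfcₙ_nnreal _
  obtain ⟨g, hg⟩ := exists_Linfty_setIntegral_eq_of_le (hP.vectorMeasure_apply_le hb1 hb w)
    (hP.vectorMeasure_absolutelyContinuous w)
  refine ⟨g, fun Δ hΔ => ?_⟩
  have hgcomm : Commute (hP.integral g) (P Δ) :=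
    hP.commute_of_mem_bicommutant (le_bicommutant _ ⟨g, rfl⟩) hΔ
  calc inner ℂ (P Δ w) (hP.integral g w)
      = ∫ s in Δ, g s ∂hP.vectorMeasure w := by
        rw [hP.inner_apply_of_commute hΔ hgcomm, hP.inner_integral, hP.vectorMeasure_apply_self hΔ]
    _ = inner ℂ (b w) (P Δ (b w)) := by rw [hg Δ hΔ, hP.ofReal_vectorMeasure_real hΔ]
    _ = inner ℂ (P Δ (b w)) (b w) := ((hP.nonneg Δ hΔ).isSelfAdjoint.isSymmetric _ _).symm
    _ = inner ℂ (b (P Δ w)) (b w) := by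
        rw [← mul_apply_eq_comp, ← (hb Δ hΔ).eq, mul_apply_eq_comp]
    _ = inner ℂ (P Δ w) (b (b w)) := hbstar.isSymmetric _ _
    _ = inner ℂ (P Δ w) (B w) := by rw [← hbb, mul_apply_eq_comp]

theorem exists_integral_apply_eq {B : K →L[ℂ] K}
    (hB : B ∈ bicommutant hP.integralAlgebra) (hB0 : 0 ≤ B)
    (hB1 : B ≤ 1) (w : K) : ∃ g, hP.integral g w = B w := by
  obtain ⟨g, hg⟩ := hP.exists_inner_integral_eq hB0 hB1
    (fun Δ => hP.commute_of_mem_bicommutant hB) w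
  have hdiff : B - hP.integral g ∈ bicommutant hP.integralAlgebra :=
    sub_mem hB (le_bicommutant _ ⟨g, rfl⟩)
  have horth (f : Lp ℂ ∞ ν) : inner ℂ (hP.integral f w) ((B - hP.integral g) w) = 0 := by
    refine Linfty_induction (p := fun f => inner ℂ (hP.integral f w) ((B - hP.integral g) w) = 0) f
      (isClosed_eq (by fun_prop) continuous_const)
      (fun f f' hf hf' => by rw [map_add, add_apply, inner_add_left, hf, hf', add_zero])
      fun Δ hΔ c => ?_
    rw [hP.integral_indicatorLinfty, smul_apply, inner_smul_left, sub_apply, inner_sub_right,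
      hg Δ hΔ, sub_self, mul_zero]
  have hclosed : IsClosed {k | inner ℂ k ((B - hP.integral g) w) = 0} :=
    isClosed_eq (by fun_prop) continuous_const
  have hself : inner ℂ ((B - hP.integral g) w) ((B - hP.integral g) w) = 0 :=
    closure_minimal (by rintro _ ⟨_, ⟨f, rfl⟩, rfl⟩; exact horth f) hclosed
      (apply_mem_closure_of_mem_bicommutant hdiff w)
  exact ⟨g, (sub_eq_zero.mp (inner_self_eq_zero.mp hself)).symm⟩

theorem integralAlgebra_amplification :
    hP.amplification.integralAlgebra = hP.integralAlgebra.map (amplification K) := by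
  refine SetLike.ext' ?_
  rw [StarSubalgebra.coe_map, coe_integralAlgebra, coe_integralAlgebra, ← Set.range_comp]
  exact congrArg Set.range (funext hP.toIsPOVM.integral_amplification)

theorem bicommutant_integralAlgebra (w : lp (fun _ : ℕ => K) 2)
    (hw : ∀ B ∈ bicommutant hP.integralAlgebra, amplification K B w = 0 → B = 0) :
    bicommutant hP.integralAlgebra = hP.integralAlgebra := by
  refine le_antisymm (fun B hB => ?_) (le_bicommutant _)
  refine Submodule.span_le (p := hP.integralAlgebra.toSubalgebra.toSubmodule).mpr ?_
    (mem_span_nonneg_le_one hB)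
  rintro B ⟨hB, hB0, hB1⟩
  have hamp : amplification K B ∈ bicommutant hP.amplification.integralAlgebra := by
    rw [hP.integralAlgebra_amplification]
    exact amplification_mem_bicommutant hB
  obtain ⟨g, hg⟩ := hP.amplification.exists_integral_apply_eq hamp (map_nonneg _ hB0)
    ((OrderHomClass.mono (amplification K) hB1).trans_eq (map_one _)) w
  refine ⟨g, (sub_eq_zero.mp (hw _ (sub_mem hB (le_bicommutant _ ⟨g, rfl⟩)) ?_)).symm⟩
  rw [map_sub, sub_apply, ← hP.toIsPOVM.integral_amplification, hg, sub_self]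

end IsSpectralMeasure

end SpectralBicommutant

section CPMeasureDerivative

/-! ### Radon–Nikodym derivatives of CP-measures -/

variable {X : Type*} [CStarAlgebra X] [PartialOrder X] [StarOrderedRing X]
  {H : Type*} [NormedAddCommGroup H] [InnerProductSpace ℂ H] [CompleteSpace H]
  {K : Type*} [NormedAddCommGroup K] [InnerProductSpace ℂ K] [CompleteSpace K]
  {M : VonNeumannAlgebra H} {S : Type*} [MeasurableSpace S]

namespace CPMeasure

variable (μ : CPMeasure X M S) {Δ Δ' : Set S}

theorem scalarMeasure_apply {ρ : M.toStarSubalgebra →ₗ[ℂ] ℂ} (hρ : M.IsNormal ρ) (x : X)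
    (hΔ : MeasurableSet Δ) : μ.scalarMeasure hρ x Δ = ρ (μ Δ x) :=
  if_pos hΔ

theorem union (hΔ : MeasurableSet Δ) (hΔ' : MeasurableSet Δ') (hd : Disjoint Δ Δ') (x : X) :
    (μ (Δ ∪ Δ') x : H →L[ℂ] H) = μ Δ x + μ Δ' x := by
  refine ContinuousLinearMap.ext fun η => ext_inner_left ℂ fun ξ => ?_
  have h := VectorMeasure.of_union (v := μ.scalarMeasure (isNormal_vectorFunctional M ξ η) x)
    hd hΔ hΔ'
  rwa [μ.scalarMeasure_apply _ _ (hΔ.union hΔ'), μ.scalarMeasure_apply _ _ hΔ,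
    μ.scalarMeasure_apply _ _ hΔ', vectorFunctional_apply, vectorFunctional_apply,
    vectorFunctional_apply, ← inner_add_right, ← add_apply] at h

theorem le_univ (hΔ : MeasurableSet Δ) : μ Δ ≤ μ Set.univ :=
  CPMap.le_iff_exists_add.mpr ⟨μ Δᶜ, fun x => by
    rw [← μ.union hΔ hΔ.compl disjoint_compl_right, Set.union_compl_self]⟩

end CPMeasure

namespace MinimalStinespring

variable {T : CPMap X M} (D : MinimalStinespring K T) {R C : K →L[ℂ] K}

theorem eq_zero_of_compress_one_eq_zero (hR : ∀ x, Commute R (D.π x)) (hR0 : 0 ≤ R)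
    (h : D.compress 1 R = 0) : R = 0 := by
  obtain ⟨b, rfl⟩ := exists_star_mul_self_eq hR0
  have hb : ∀ ξ, b (D.V ξ) = 0 := fun ξ => by
    have hξ := D.inner_compress 1 (star b * b) ξ ξ
    rwa [h, zero_apply, inner_zero_right, map_one, one_apply_eq_self, mul_apply_eq_comp,
      ContinuousLinearMap.star_eq_adjoint, ContinuousLinearMap.adjoint_inner_right, eq_comm,
      inner_self_eq_zero] at hξ
  refine D.ext fun x ξ => ?_
  rw [← mul_apply_eq_comp, (hR x).eq, mul_apply_eq_comp, mul_apply_eq_comp, hb, map_zero, map_zero,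
    zero_apply]

theorem eq_zero_of_mem_liftCommutant {ξ η : lp (fun _ : ℕ => H) 2}
    (hfaithful : ∀ a ∈ M.toStarSubalgebra, 0 ≤ a → traceClassFunctional ξ η a = 0 → a = 0)
    (hC : C ∈ D.liftCommutant) (hCη : ∀ n, C (D.V (η n)) = 0) : C = 0 := by
  refine (CStarRing.star_mul_self_eq_zero_iff C).mp ?_
  have hmem : star C * C ∈ D.liftCommutant := mul_mem (star_mem hC) hC
  obtain ⟨T', hT'⟩ := exists_isRNDerivative_of_nonneg hmem (star_mul_self_nonneg C)
  refine D.eq_zero_of_compress_one_eq_zero hT'.commute (star_mul_self_nonneg C) ?_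
  rw [hT'.compress_eq]
  refine hfaithful _ (T' 1).2 (map_nonneg T'.toCompletelyPositiveMap zero_le_one) ?_
  rw [← hT'.compress_eq, traceClassFunctional]
  simp_rw [D.inner_compress, map_one, one_apply_eq_self, mul_apply_eq_comp, hCη, map_zero,
    inner_zero_right, tsum_zero]

/-- `P` assigns to every measurable set `Δ` the Radon–Nikodym derivative of `μ(Δ)`. -/
def IsDerivative (μ : CPMeasure X M S) (P : Set S → K →L[ℂ] K) : Prop :=
  ∀ Δ, MeasurableSet Δ → D.IsRNDerivative (P Δ) (μ Δ)

variable {μ : CPMeasure X M S} {ν : Measure S}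

theorem exists_isDerivative (hμ : μ Set.univ = T) :
    ∃ P : Set S → K →L[ℂ] K, D.IsDerivative μ P := by
  have hRN : ∀ Δ, ∃ R : K →L[ℂ] K, MeasurableSet Δ → D.IsRNDerivative R (μ Δ) := fun Δ => by
    by_cases hΔ : MeasurableSet Δ
    · obtain ⟨R, hR⟩ := D.exists_isRNDerivative (hμ ▸ μ.le_univ hΔ)
      exact ⟨R, fun _ => hR⟩
    · exact ⟨0, fun h => absurd h hΔ⟩
  choose P hP using hRN
  exact ⟨P, hP⟩

variable {D}

theorem kappa_unique {κ κ' : Lp ℂ ∞ ν →ₗ[ℂ] (K →L[ℂ] K)} (hκ : μ.IsKappa D ν κ)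
    (hκ' : μ.IsKappa D ν κ') : κ' = κ := by
  have hcomm : ∀ {κ}, μ.IsKappa D ν κ → ∀ f x, Commute (κ f) (D.π x) := fun h f =>
    (mem_liftCommutant_iff.mp (relCommutant_eq_liftCommutant.subset (h.mem_relCommutant f))).1
  refine LinearMap.ext fun f => D.ext_compress (hcomm hκ' f) (hcomm hκ f) fun x => ?_
  obtain ⟨a, ha, hρa⟩ := hκ.integral_eq f x
  obtain ⟨a', ha', hρa'⟩ := hκ'.integral_eq f x
  refine ha'.symm.trans (Eq.trans ?_ ha)
  refine ContinuousLinearMap.ext fun η => ext_inner_left ℂ fun ξ => ?_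
  rw [← vectorFunctional_apply, ← vectorFunctional_apply,
    hρa' _ (isNormal_vectorFunctional M ξ η), hρa _ (isNormal_vectorFunctional M ξ η)]

namespace IsDerivative

variable {P : Set S → K →L[ℂ] K} {ρ : M.toStarSubalgebra →ₗ[ℂ] ℂ}

theorem eq_zero_iff (hP : D.IsDerivative μ P) (hρ : M.IsNormalFaithfulState ρ) {Δ : Set S}
    (hΔ : MeasurableSet Δ) : P Δ = 0 ↔ ρ (μ Δ 1) = 0 := by
  have hcompress := (hP Δ hΔ).compress_eq 1
  constructor
  · intro h
    rw [h, map_zero] at hcompress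
    rw [show μ Δ 1 = 0 from Subtype.ext hcompress.symm, map_zero]
  · intro h
    refine D.eq_zero_of_compress_one_eq_zero (hP Δ hΔ).commute (hP Δ hΔ).nonneg ?_
    rw [hcompress, hρ.faithful _ (map_nonneg (μ Δ).toCompletelyPositiveMap zero_le_one) h]
    rfl

theorem isPOVM [IsFiniteMeasure ν] (hP : D.IsDerivative μ P) (hμ : μ Set.univ = T)
    (hρ : M.IsNormalFaithfulState ρ) (hν : μ.IsEquivalentTo ρ ν) : IsPOVM ν P := by
  refine isPOVM_of_dense_span (fun Δ hΔ => (hP Δ hΔ).nonneg) ?_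
    (fun Δ hΔ hnull => (hP.eq_zero_iff hρ hΔ).mpr ((hν Δ hΔ).mp hnull)) (fun Δ Δ' hΔ hΔ' hd => ?_)
    (Submodule.dense_iff_topologicalClosure_eq_top.mpr D.dense) ?_
  · exact (hμ ▸ hP _ .univ : D.IsRNDerivative (P Set.univ) T).eq isRNDerivative_one
  · refine (hP _ (hΔ.union hΔ')).eq
      ⟨fun x => ((hP Δ hΔ).commute x).add_left ((hP Δ' hΔ').commute x), fun x => ?_⟩
    rw [map_add, (hP Δ hΔ).compress_eq, (hP Δ' hΔ').compress_eq, μ.union hΔ hΔ' hd]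
  · rintro Δ hΔ hd _ ⟨x, ξ, rfl⟩ _ ⟨y, η, rfl⟩
    have hinner : ∀ Δ, MeasurableSet Δ → inner ℂ (D.π x (D.V ξ)) (P Δ (D.π y (D.V η))) =
        vectorFunctional M ξ η (μ Δ (star x * y)) := fun Δ hΔ =>
      ((hP Δ hΔ).inner_eq x y ξ η).trans (vectorFunctional_apply M ξ η _).symm
    simpa only [hinner _ (hΔ _), hinner _ (.iUnion hΔ)] using
      μ.hasSum_iUnion Δ hΔ hd _ (isNormal_vectorFunctional M ξ η) (star x * y)

theorem isOrthogonalOf_iff (hP : D.IsDerivative μ P) (hμ : μ Set.univ = T) (hPOVM : IsPOVM ν P) :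
    μ.IsOrthogonalOf T ↔ IsSpectralMeasure ν P := by
  have horth : ∀ Δ, MeasurableSet Δ → ((μ Δ).Orthogonal (μ Δᶜ) ↔ P Δ * P Δ = P Δ) := fun Δ hΔ =>
    orthogonal_iff_mul_self (hP Δ hΔ) (eq_sub_of_add_eq' (hPOVM.add_compl hΔ) ▸ hP Δᶜ hΔ.compl)
  exact ⟨fun h => ⟨hPOVM, fun Δ hΔ => (horth Δ hΔ).mp (h.2 Δ hΔ)⟩,
    fun h => ⟨hμ, fun Δ hΔ => (horth Δ hΔ).mpr (h.mul_self Δ hΔ)⟩⟩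

variable [IsFiniteMeasure ν]

theorem integral_mem_liftCommutant (hP : D.IsDerivative μ P) (hPOVM : IsPOVM ν P)
    (f : Lp ℂ ∞ ν) : hPOVM.integral f ∈ D.liftCommutant := by
  refine Linfty_induction (p := fun f => hPOVM.integral f ∈ D.liftCommutant) f
    (isClosed_liftCommutant.preimage hPOVM.integral.continuous)
    (fun f g hf hg => by rw [map_add]; exact add_mem hf hg) fun Δ hΔ c => ?_
  rw [hPOVM.integral_indicatorLinfty]
  exact D.liftCommutant.smul_mem (hP Δ hΔ).mem_liftCommutant c

theorem isKappa (hP : D.IsDerivative μ P) (hPOVM : IsPOVM ν P) :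
    μ.IsKappa D ν hPOVM.integral.toLinearMap where
  mem_relCommutant f :=
    relCommutant_eq_liftCommutant.superset (hP.integral_mem_liftCommutant hPOVM f)
  integral_eq f x := by
    refine ⟨⟨D.compress x (hPOVM.integral f),
      (mem_liftCommutant_iff.mp (hP.integral_mem_liftCommutant hPOVM f)).2 x⟩, rfl,
      fun ρ hρ => ?_⟩
    obtain ⟨ξ, η, hξη⟩ := id hρ
    have hmeas : ∀ Δ, MeasurableSet Δ →
        μ.scalarMeasure hρ x Δ = traceClassCLM ξ η (D.compress x (P Δ)) := fun Δ hΔ => by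
      rw [μ.scalarMeasure_apply _ _ hΔ, hξη, (hP Δ hΔ).compress_eq]
      rfl
    rw [hξη, ← eq_vectorIntegral_of_indicatorLinfty
      (φ := traceClassCLM ξ η ∘L D.compress x ∘L hPOVM.integral) (fun Δ hΔ hnull => ?_)
      fun Δ hΔ c => ?_]
    · rfl
    · rw [hmeas Δ hΔ, hPOVM.null Δ hΔ hnull, map_zero, map_zero]
    · simp only [ContinuousLinearMap.comp_apply, hPOVM.integral_indicatorLinfty, map_smul,
        hmeas Δ hΔ, smul_eq_mul]

theorem bicommutant_integralAlgebra (hP : D.IsDerivative μ P) (hspec : IsSpectralMeasure ν P)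
    (hρ : M.IsNormalFaithfulState ρ) :
    bicommutant hspec.integralAlgebra = hspec.integralAlgebra := by
  obtain ⟨ξ, η, hξη⟩ := hρ.normal
  have hfaithful : ∀ a ∈ M.toStarSubalgebra, 0 ≤ a → traceClassFunctional ξ η a = 0 → a = 0 :=
    fun a ha ha0 h => congrArg Subtype.val (hρ.faithful ⟨a, ha⟩ ha0 ((hξη _).trans h))
  have hle : bicommutant hspec.integralAlgebra ≤ D.liftCommutant :=
    bicommutant_le_centralizer fun _ ⟨f, hf⟩ =>
      hf ▸ hP.integral_mem_liftCommutant hspec.toIsPOVM f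
  refine hspec.bicommutant_integralAlgebra
    (lp.mapCLM 2 (fun _ => D.V) (norm_nonneg _) (fun _ => le_rfl) η) fun B hB hBη => ?_
  exact D.eq_zero_of_mem_liftCommutant hfaithful (hle hB) fun n => congrArg (· n) hBη

theorem exists_vonNeumannAlgebra (hP : D.IsDerivative μ P) (hspec : IsSpectralMeasure ν P)
    (hρ : M.IsNormalFaithfulState ρ) :
    ∃ B : VonNeumannAlgebra K, (B : Set (K →L[ℂ] K)) = Set.range hspec.integral ∧
      (∀ a ∈ B, ∀ b ∈ B, a * b = b * a) ∧ (B : Set (K →L[ℂ] K)) ⊆ D.relCommutant := by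
  refine ⟨⟨hspec.integralAlgebra, ?_⟩, rfl, ?_, ?_⟩
  · exact (coe_bicommutant _).symm.trans
      (congrArg SetLike.coe (hP.bicommutant_integralAlgebra hspec hρ))
  · rintro _ ⟨f, rfl⟩ _ ⟨g, rfl⟩
    exact hspec.integral_mul_comm f g
  · rintro _ ⟨f, rfl⟩
    exact (hP.isKappa hspec.toIsPOVM).mem_relCommutant f

end IsDerivative

end MinimalStinespring

end CPMeasureDerivative

theorem mainTheorem5
    {X : Type*} [CStarAlgebra X] [PartialOrder X] [StarOrderedRing X]
    {H : Type*} [NormedAddCommGroup H] [InnerProductSpace ℂ H] [CompleteSpace H]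
    {K : Type*} [NormedAddCommGroup K] [InnerProductSpace ℂ K] [CompleteSpace K]
    (M : VonNeumannAlgebra H) (hM : M.IsSigmaFinite)
    {S : Type*} [MeasurableSpace S]
    (T : CPMap X M) (D : MinimalStinespring K T)
    (μ : CPMeasure X M S) (hμ : μ Set.univ = T)
    (ν : Measure S) [IsFiniteMeasure ν]
    (hν : ∃ ρ : M.toStarSubalgebra →ₗ[ℂ] ℂ, M.IsNormalFaithfulState ρ ∧ μ.IsEquivalentTo ρ ν) :
    ∃ κ : Lp ℂ ∞ ν →ₗ[ℂ] (K →L[ℂ] K),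
      μ.IsKappa D ν κ ∧ (∀ κ', μ.IsKappa D ν κ' → κ' = κ) ∧
      List.TFAE [
        μ.IsOrthogonalOf T,
        IsStarRepresentation κ ∧ Function.Injective κ,
        IsStarRepresentation κ] ∧
      (μ.IsOrthogonalOf T →
        ∃ B : VonNeumannAlgebra K, (B : Set (K →L[ℂ] K)) = Set.range κ ∧
          (∀ a ∈ B, ∀ b ∈ B, a * b = b * a) ∧ (B : Set (K →L[ℂ] K)) ⊆ D.relCommutant) := by
  obtain ⟨ρ, hρ, hρν⟩ := hν
  obtain ⟨P, hP⟩ := D.exists_isDerivative hμ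
  have hPOVM := hP.isPOVM hμ hρ hρν
  have hkappa := hP.isKappa hPOVM
  have hiff := hP.isOrthogonalOf_iff hμ hPOVM
  refine ⟨_, hkappa, fun κ' hκ' => MinimalStinespring.kappa_unique hkappa hκ', ?_,
    fun horth => hP.exists_vonNeumannAlgebra (hiff.mp horth) hρ⟩
  tfae_have 1 → 2 := fun horth =>
    have hspec := hiff.mp horth
    ⟨⟨hspec.integral_smul, hspec.integral_star⟩, hspec.integral_injective fun Δ hΔ h =>
      (hρν Δ hΔ).mpr ((hP.eq_zero_iff hρ hΔ).mp h)⟩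
  tfae_have 2 → 3 := And.left
  tfae_have 3 → 1 := fun h => hiff.mpr (hPOVM.isSpectralMeasure_of_integral_smul h.map_mul)
  tfae_finish
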